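/- Let $a<b$ be coprime positive integers. For $n\ge 1$ let $G_{a,b}(n)$ be the graph on $\{0,1,\dots,n-1\}$ in which $x,y$ are adjacent iff $|x-y|\in\{a,b\}$. For $1\le s\le b$ regard $\{0,\dots,b+s-1\}$ as two columns: the left column $\{0,\dots,b-1\}$ and the right column $\{b,\dots,b+s-1\}$, with $i$ (respectively $b+i$) being row $i$ of the left (respectively right) column. *Blocks.* A block is a spanning subgraph $B$ of $G_{a,b}(b+s)$, $1\le s\le b$, with all degrees at most $2$, which is of one of the following types: a *start block*, if $s=b$ and every left vertex has degree $2$; a *mid block*, if $s=b$, some right vertex has degree at most $1$, and no two left vertices are adjacent; an *end block*, if every right vertex has degree $2$ and no two left vertices are adjacent. For a sequence of blocks $B_1,\dots,B_m$, all but the last with right columns of length $b$, let $\mathcal G(B_1,\dots,B_m)$ be the graph obtained by identifying row $i$ of the right column of $B_j$ with row $i$ of the left column of $B_{j+1}$ for all $i<b$, $j<m$; row $i$ of its $k$-th column (counted from $k=0$) is labelled $kb+i$. A pair $(B,B')$ of blocks is *compatible* if the right column of $B$ has length $b$ and every vertex in the middle column of $\mathcal G(B,B')$ has degree $2$. *Labels.*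 For a graph $H$ on two such columns let $\mathcal L(H)$ be the set of unordered pairs $\{i,j\}$ such that $H$ has a path with at least one edge whose end vertices both have degree $1$ in $H$ and lie in rows $i$ and $j$ of the right column. For a mid or end block $B$ and a set $L$ of unordered pairs of elements of $\{0,\dots,b-1\}$ let $B^L$ be obtained from $B$ by adding an edge between rows $i$ and $j$ of the left column for every $\{i,j\}\in L$. *The weighted digraph $D_{a,b}$.* Its vertices are: a start vertex $S$; the pairs $(B,\mathcal L(B))$ with $B$ a start block; the pairs $(B,L)$ with $B$ a mid block and $L$ any set of pairs as above; and the end vertices $B$, with $B$ an end block. Its edges are: 1. $S\to(B,\mathcal L(B))$, of weight $2b$, for every acyclic start block $B$; 2. $(B,L)\to(\hat B,\hat L)$, of weight $b$, whenever $\hat B$ is a mid block, $(B,\hat B)$ is compatible, $\mathcal L(\hat B^L)=\hat L$ and $\hat B^L$ is acyclic; 3. $(B,L)\to\hat B$, of weight the length of the right column of $\hat B$, whenever $\hat B$ is an end block, $(B,\hat B)$ is compatible and $\hat B^L$ with all its isolated vertices removed is a cycle. **Theorem.** The digraph $D_{a,b}$ is finite. For every $n>2b$ the Hamiltonian cycles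 of $G_{a,b}(n)$ (as undirected subgraphs) are in one-to-one correspondence with the walks in $D_{a,b}$ from $S$ to an end vertex whose edge weights sum to $n$. The correspondence can be chosen such that a Hamiltonian cycle $C$ corresponds to a walk $S\to(B_1,L_1)\to\dots\to(B_{q-1},L_{q-1})\to B_q$ with $C=\mathcal G(B_1,\dots,B_q)$. -/

import Mathlib

namespace Necklace

/-- The graph `G_{a,b}(n)` on `{0, …, n-1}`: `x` and `y` are adjacent iff `|x - y| ∈ {a, b}`
(for positive `a`, `b` the clause `x ≠ y` is redundant). -/
def necklaceGraph (a b n : ℕ) : SimpleGraph (Fin n) where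
  Adj x y := x ≠ y ∧ (|(x : ℤ) - (y : ℤ)| = a ∨ |(x : ℤ) - (y : ℤ)| = b)
  symm := ⟨fun x y h => ⟨h.1.symm, by rw [abs_sub_comm (y : ℤ) (x : ℤ)]; exact h.2⟩⟩
  loopless := ⟨fun _ h => h.1 rfl⟩

/-- The Hamiltonian cycles of `G`, as (undirected, unrooted) subgraphs of `G`. -/
def hamiltonianCycles {V : Type*} [DecidableEq V] (G : SimpleGraph V) : Set G.Subgraph :=
  {H | ∃ (v : V) (p : G.Walk v v), p.IsHamiltonianCycle ∧ p.toSubgraph = H}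

/-- The degree of a vertex, as the cardinality of its neighbourhood. -/
noncomputable def deg {V : Type*} (G : SimpleGraph V) (v : V) : ℕ := (G.neighborSet v).ncard

/-- `G` is a cycle: some closed walk of `G` without repetitions runs through all of `G`. -/
def IsCycleGraph {V : Type*} (G : SimpleGraph V) : Prop :=
  ∃ (v : V) (p : G.Walk v v), p.IsCycle ∧ p.toSubgraph = ⊤

/-- The graph obtained from `G` by removing all isolated vertices. -/
def removeIsolated {V : Type*} (G : SimpleGraph V) : SimpleGraph G.support :=
  G.induce G.support

/-! ### Two-column graphs and blocks -/

/-- A graph on two columns: the left column has length `b` (vertex `i` is row `i` of the left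
column, `i < b`), the right column has length `rightLen` (vertex `b + i` is row `i` of the right
column, `i < rightLen`). -/
structure TwoColumn (b : ℕ) where
  rightLen : ℕ
  graph : SimpleGraph (Fin (b + rightLen))

namespace TwoColumn

variable {b : ℕ}

/-- The vertex in row `i` of the left column. -/
def left (B : TwoColumn b) (i : Fin b) : Fin (b + B.rightLen) := Fin.castAdd B.rightLen i

/-- The vertex in row `i` of the right column. -/
def right (B : TwoColumn b) (i : Fin B.rightLen) : Fin (b + B.rightLen) := Fin.natAdd b i

/-- `B` is a spanning subgraph of `G_{a,b}(b + s)`, where `s` is the length of its right column,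
and has maximum degree at most two. -/
def IsPreBlock (a : ℕ) (B : TwoColumn b) : Prop :=
  B.graph ≤ necklaceGraph a b (b + B.rightLen) ∧ ∀ v, deg B.graph v ≤ 2

/-- No two vertices in the left column are adjacent. -/
def NoLeftEdge (B : TwoColumn b) : Prop :=
  ∀ i j : Fin b, ¬ B.graph.Adj (B.left i) (B.left j)

/-- Start blocks. -/
def IsStart (a : ℕ) (B : TwoColumn b) : Prop :=
  B.IsPreBlock a ∧ B.rightLen = b ∧ ∀ i, deg B.graph (B.left i) = 2

/-- Mid blocks. -/
def IsMid (a : ℕ) (B : TwoColumn b) : Prop :=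
  B.IsPreBlock a ∧ B.rightLen = b ∧ (∃ i, deg B.graph (B.right i) ≤ 1) ∧ B.NoLeftEdge

/-- End blocks. -/
def IsEnd (a : ℕ) (B : TwoColumn b) : Prop :=
  B.IsPreBlock a ∧ 1 ≤ B.rightLen ∧ B.rightLen ≤ b ∧
    (∀ i, deg B.graph (B.right i) = 2) ∧ B.NoLeftEdge

/-- The set `𝓛(H)` of all unordered pairs `{i, j}` of rows such that `H` contains a path
(a path component with at least one edge, so that its two end vertices have degree one) whose end
vertices are in the right column of `H`, at rows `i` and `j`. -/
def pathEnds (H : TwoColumn b) : Set (Sym2 (Fin b)) :=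
  {e | ∃ (i j : Fin b) (u v : Fin (b + H.rightLen)) (p : H.graph.Walk u v),
    e = s(i, j) ∧ (u : ℕ) = b + i ∧ (v : ℕ) = b + j ∧
    p.IsPath ∧ 0 < p.length ∧ deg H.graph u = 1 ∧ deg H.graph v = 1}

/-- The graph `B^L`: add to `B` an edge joining rows `i` and `j` of the left column for every
`{i, j} ∈ L`. -/
def augment (B : TwoColumn b) (L : Set (Sym2 (Fin b))) : TwoColumn b where
  rightLen := B.rightLen
  graph := B.graph ⊔ (SimpleGraph.fromEdgeSet L).map (Fin.castAddEmb B.rightLen)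

/-- The graph `𝒢(B₀, B₁, …)` obtained by identifying row `i` of the right column of each block
with row `i` of the left column of the next one. Columns are numbered from left to right and
row `i` of column `j` is the number `j * b + i`, so that the vertex `u` of the `j`-th block
(`j` counted from `0`) becomes `j * b + u`. The vertices of `𝒢(B₀, B₁, …)` are the numbers below
the total number of vertices; the remaining naturals are isolated here. -/
def glue (Bs : List (TwoColumn b)) : SimpleGraph ℕ where
  Adj x y := ∃ (j : Fin Bs.length) (u v : Fin (b + (Bs.get j).rightLen)),
    (Bs.get j).graph.Adj u v ∧ x = j * b + u ∧ y = j * b + v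
  symm := ⟨by
    rintro x y ⟨j, u, v, h, hx, hy⟩
    exact ⟨j, v, u, h.symm, hy, hx⟩⟩
  loopless := ⟨by
    rintro x ⟨j, u, v, h, hx, hy⟩
    exact h.ne (Fin.ext (Nat.add_left_cancel (hx.symm.trans hy)))⟩

/-- `(B, B')` is compatible: the right column of `B` has length `b` and every vertex in the
middle column of `𝒢(B, B')` has degree two. -/
def Compatible (B B' : TwoColumn b) : Prop :=
  B.rightLen = b ∧ ∀ i : Fin b, deg (glue [B, B']) (b + i) = 2

end TwoColumn

/-! ### Weighted digraphs and walks -/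

/-- A digraph with natural number weights on its edges
(values of `weight` at non-adjacent pairs are irrelevant). -/
structure WeightedDigraph (V : Type*) extends Digraph V where
  weight : V → V → ℕ

namespace WeightedDigraph

variable {V : Type*}

/-- Walks in a weighted digraph. -/
inductive Walk (D : WeightedDigraph V) : V → V → Type _
  | nil (u : V) : Walk D u u
  | cons {u v w : V} (h : D.Adj u v) (p : Walk D v w) : Walk D u w

/-- The sum of the edge weights of a walk. -/
def Walk.weightSum {D : WeightedDigraph V} : {u v : V} → D.Walk u v → ℕ
  | _, _, .nil _ => 0
  | _, _, .cons (u := u) (v := v) _ p => D.weight u v + p.weightSum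

/-- The vertices of a walk, in order. -/
def Walk.vertices {D : WeightedDigraph V} : {u v : V} → D.Walk u v → List V
  | _, _, .nil u => [u]
  | _, _, .cons (u := u) _ p => u :: p.vertices

end WeightedDigraph

/-! ### The digraph `D_{a,b}` -/

/-- The vertices of `D_{a,b}`: the start vertex `S`, the pairs `(B, L)` where either `B` is a
start block and `L = 𝓛(B)`, or `B` is a mid block and `L` is any set of pairs of rows, and the
end vertices `B`, where `B` is an end block. -/
inductive DVertex (a b : ℕ) : Type
  | S
  | pair (B : TwoColumn b) (L : Set (Sym2 (Fin b)))
      (h : (B.IsStart a ∧ L = B.pathEnds) ∨ B.IsMid a)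
  | fin (B : TwoColumn b) (h : B.IsEnd a)

namespace DVertex

variable {a b : ℕ}

/-- End vertices. -/
def IsEndVertex : DVertex a b → Prop
  | fin _ _ => True
  | _ => False

/-- The block of a vertex other than `S`. -/
def block? : DVertex a b → Option (TwoColumn b)
  | S => none
  | pair B _ _ => some B
  | fin B _ => some B

/-- The edge relation of `D_{a,b}`. -/
def Edge : DVertex a b → DVertex a b → Prop
  | S, pair B L _ => B.IsStart a ∧ L = B.pathEnds ∧ B.graph.IsAcyclic
  | pair B L _, pair B' L' _ => B'.IsMid a ∧ B.Compatible B' ∧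
      (B'.augment L).pathEnds = L' ∧ (B'.augment L).graph.IsAcyclic
  | pair B L _, fin B' _ => B.Compatible B' ∧
      IsCycleGraph (removeIsolated (B'.augment L).graph)
  | _, _ => False

/-- The edge weights of `D_{a,b}`. -/
def edgeWeight : DVertex a b → DVertex a b → ℕ
  | S, pair _ _ _ => 2 * b
  | pair _ _ _, pair _ _ _ => b
  | pair _ _ _, fin B' _ => B'.rightLen
  | _, _ => 0

end DVertex

/-- The weighted digraph `D_{a,b}`. -/
def necklaceDigraph (a b : ℕ) : WeightedDigraph (DVertex a b) where
  Adj := DVertex.Edge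
  weight := DVertex.edgeWeight

/-- A walk in `D_{a,b}` from `S` to some end vertex with sum of edge weights `n`. -/
structure EndWalk (a b n : ℕ) where
  target : DVertex a b
  walk : (necklaceDigraph a b).Walk DVertex.S target
  isEnd : target.IsEndVertex
  weightSum_eq : walk.weightSum = n

/-- The sequence of blocks along a walk. -/
def EndWalk.blocks {a b n : ℕ} (W : EndWalk a b n) : List (TwoColumn b) :=
  W.walk.vertices.filterMap DVertex.block?

end Necklace

/-! Every edge of $G_{a,b}(n)$ has length at most $b$. Once the numbers are cut into columns of
length $b$, an edge stays inside a column or joins two consecutive ones. A Hamiltonian cycle is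
therefore determined by its restriction to the first two columns and, for each later column, the
edges that reach it from the left or lie in it. These are the blocks. The point is that one can
decide block by block whether the glued graph is a single cycle, remembering only the labels.

Let $H$ be glued from an initial segment of a walk: acyclic, of maximum degree two, with degree two
before its last column. Its nontrivial components are paths with both ends in the last column. For
edges added later, such a path matters only through its two ends, so it may be replaced by one edge,
which gives `pathContraction H`. The label $L$ is exactly this matching, so $B^L$ is the contraction
of $H$ together with $B$ (`placed_augment`). Contraction preserves degrees at, and reachability
between, the vertices of degree at most one in $H$ (`IsExtension`). Hence acyclicity, being a single
cycle, and the next label can all be read off $B^L$ instead of the whole glued graph. `IsState` is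
the resulting invariant and `IsState.step` propagates it. Acyclicity is handled as `ReachesEnds`,
which transfers directly along embeddings and contractions (`isAcyclic_iff_reachesEnds`).

Conversely, a proper initial segment of a Hamiltonian cycle has no cyclic component, because the
cycle is connected (`reachesEnds_below`); cutting it into windows yields a walk (`exists_endWalk`).
The walk is unique: only the start block may have edges inside its left column, so the glued graph
determines the blocks, the edges of the digraph determine the labels, and the total weight fixes
where the walk stops (`walk_eq_of_glueFrom_eq`). -/

namespace Necklace

open SimpleGraph

/-! ### Graphs of maximum degree two in terms of degrees and reachability -/

section Graphs

variable {V W : Type*} {G : SimpleGraph V}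

/-- Every vertex can reach a vertex of degree at most one. For finite graphs of maximum degree two
this is equivalent to acyclicity. -/
def ReachesEnds (G : SimpleGraph V) : Prop :=
  ∀ v, ∃ w, G.Reachable v w ∧ deg G w ≤ 1

/-- Apart from isolated vertices, the graph is two-regular, connected and nonempty. -/
structure IsSingleCycle (G : SimpleGraph V) : Prop where
  exists_deg_ne : ∃ v, deg G v ≠ 0
  deg_eq : ∀ v, deg G v = 0 ∨ deg G v = 2
  reachable : ∀ v w, deg G v ≠ 0 → deg G w ≠ 0 → G.Reachable v w

lemma deg_ne_zero_iff {v : V} (hf : (G.neighborSet v).Finite) :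
    deg G v ≠ 0 ↔ ∃ w, G.Adj v w := by
  rw [deg, ← Nat.pos_iff_ne_zero, Set.ncard_pos hf]
  rfl

lemma not_adj_of_deg_eq_zero {v w : V} (hf : (G.neighborSet v).Finite) (h : deg G v = 0) :
    ¬ G.Adj v w :=
  fun hvw => (deg_ne_zero_iff hf).2 ⟨w, hvw⟩ h

lemma exists_adj_of_reachable_ne {v w : V} (h : G.Reachable v w) (hne : v ≠ w) :
    ∃ x, G.Adj v x := by
  obtain ⟨p⟩ := h
  cases p with
  | nil => exact absurd rfl hne
  | cons h _ => exact ⟨_, h⟩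

lemma deg_ne_zero_of_reachable_ne {v w : V} (hf : (G.neighborSet v).Finite)
    (h : G.Reachable v w) (hne : v ≠ w) : deg G v ≠ 0 :=
  (deg_ne_zero_iff hf).2 (exists_adj_of_reachable_ne h hne)

/-- The induction principle behind most reachability arguments below: a set closed under adjacency
is a union of components. -/
lemma mem_of_reachable {S : Set V} (hS : ∀ x ∈ S, ∀ y, G.Adj x y → y ∈ S) {v w : V}
    (h : G.Reachable v w) (hv : v ∈ S) : w ∈ S := by
  obtain ⟨p⟩ := h
  induction p with
  | nil => exact hv
  | cons h _ ih => exact ih (hS _ hv _ h)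

lemma deg_mono {G' : SimpleGraph V} {v : V} (h : G ≤ G') (hf : (G'.neighborSet v).Finite) :
    deg G v ≤ deg G' v :=
  Set.ncard_le_ncard (fun _ hw => h hw) hf

/-- The connected component of `v`, with all other vertices isolated. -/
def componentGraph (G : SimpleGraph V) (v : V) : SimpleGraph V where
  Adj x y := G.Adj x y ∧ G.Reachable v x
  symm := ⟨fun _ _ h => ⟨h.1.symm, h.2.trans h.1.reachable⟩⟩
  loopless := ⟨fun _ h => h.1.ne rfl⟩

lemma componentGraph_le (v : V) : componentGraph G v ≤ G := fun _ _ h => h.1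

lemma deg_componentGraph_of_reachable {v x : V} (h : G.Reachable v x) :
    deg (componentGraph G v) x = deg G x := by
  unfold deg
  congr 1
  ext y
  exact ⟨fun hy => hy.1, fun hy => ⟨hy, h⟩⟩

lemma deg_componentGraph_of_not_reachable {v x : V} (h : ¬ G.Reachable v x) :
    deg (componentGraph G v) x = 0 := by
  have : (componentGraph G v).neighborSet x = ∅ := by
    ext y
    simp only [mem_neighborSet, Set.mem_empty_iff_false, iff_false]
    exact fun hy => h hy.2
  rw [deg, this, Set.ncard_empty]

/-- The cycle already uses two edges at `v`, and degree at most two leaves room for no other. -/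
lemma toSubgraph_adj_of_isCycle [Finite V] {u v w : V} {p : G.Walk u u} (hp : p.IsCycle)
    (hv : v ∈ p.support) (hdeg : deg G v ≤ 2) (h : G.Adj v w) : p.toSubgraph.Adj v w := by
  have heq : p.toSubgraph.neighborSet v = G.neighborSet v :=
    Set.eq_of_subset_of_ncard_le (p.toSubgraph.neighborSet_subset v)
      (by rw [hp.ncard_neighborSet_toSubgraph_eq_two hv]; exact hdeg) (Set.toFinite _)
  have : w ∈ p.toSubgraph.neighborSet v := heq ▸ h
  exact this

lemma deg_eq_two_of_isCycle [Finite V] {u v : V} {p : G.Walk u u} (hp : p.IsCycle)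
    (hv : v ∈ p.support) (hdeg : deg G v ≤ 2) : deg G v = 2 := by
  refine le_antisymm hdeg ?_
  rw [← hp.ncard_neighborSet_toSubgraph_eq_two hv]
  exact Set.ncard_le_ncard (p.toSubgraph.neighborSet_subset v) (Set.toFinite _)

/-- A component without vertices of degree at most one is two-regular and so contains a cycle.
Conversely, a cycle in a graph of maximum degree two fills its whole component, which then has only
vertices of degree two. -/
theorem isAcyclic_iff_reachesEnds [Finite V] (hdeg : ∀ v, deg G v ≤ 2) :
    G.IsAcyclic ↔ ReachesEnds G := by
  constructor
  · intro hG v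
    by_contra! hcon
    have h2 : ∀ w, G.Reachable v w → deg G w = 2 := fun w hw =>
      le_antisymm (hdeg w) (hcon w hw)
    have hcyc : (componentGraph G v).IsCycles := by
      rintro x ⟨y, hy⟩
      change deg (componentGraph G v) x = 2
      rw [deg_componentGraph_of_reachable hy.2, h2 x hy.2]
    have hne : ((componentGraph G v).neighborSet v).Nonempty := by
      apply Set.nonempty_of_ncard_ne_zero
      change deg (componentGraph G v) v ≠ 0
      rw [deg_componentGraph_of_reachable (Reachable.refl v), h2 v (Reachable.refl v)]
      decide
    obtain ⟨p, hp, -⟩ := hcyc.exists_cycle_toSubgraph_verts_eq_connectedComponentSupp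
      (c := (componentGraph G v).connectedComponentMk v) rfl hne
    exact hG.anti (componentGraph_le v) p hp
  · intro h v p hp
    obtain ⟨w, hvw, hw⟩ := h v
    have hmem : w ∈ {x | x ∈ p.support} := mem_of_reachable
      (fun x hx y hxy => p.mem_verts_toSubgraph.1
        (p.toSubgraph.edge_vert (toSubgraph_adj_of_isCycle hp hx (hdeg x) hxy).symm))
      hvw p.start_mem_support
    have := deg_eq_two_of_isCycle hp hmem (hdeg w)
    omega

/-- The handshake lemma in the component of `u`: vertices of odd degree come in even number, and odd
here means one. -/
lemma exists_ne_deg_eq_one [Finite V] (hdeg : ∀ v, deg G v ≤ 2) {u : V} (hu : deg G u = 1) :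
    ∃ w, u ≠ w ∧ deg G w = 1 ∧ G.Reachable u w := by
  classical
  have := Fintype.ofFinite V
  have hd : ∀ x, (componentGraph G u).degree x = deg (componentGraph G u) x := fun x => by
    rw [← card_neighborSet_eq_degree, deg, Set.ncard_eq_toFinset_card', Set.toFinset_card]
  obtain ⟨w, hw, hodd⟩ := (componentGraph G u).exists_ne_odd_degree_of_exists_odd_degree u
    (by rw [hd, deg_componentGraph_of_reachable (Reachable.refl u), hu]; decide)
  rw [hd] at hodd
  by_cases hr : G.Reachable u w
  · rw [deg_componentGraph_of_reachable hr] at hodd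
    have := hdeg w
    refine ⟨w, hw.symm, ?_, hr⟩
    obtain ⟨k, hk⟩ := hodd
    omega
  · rw [deg_componentGraph_of_not_reachable hr] at hodd
    exact absurd hodd (by decide)

/-- A path from `u` to `w` contains all neighbours of each of its vertices, so it exhausts the
component, and its inner vertices have degree two. -/
lemma eq_of_reachable_of_deg_eq_one [Finite V] (hdeg : ∀ v, deg G v ≤ 2) {u w x : V}
    (hu : deg G u = 1) (hw : deg G w = 1) (hx : deg G x = 1) (huw : u ≠ w) (hux : u ≠ x)
    (hrw : G.Reachable u w) (hrx : G.Reachable u x) : w = x := by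
  classical
  obtain ⟨p, hp⟩ := hrw.exists_isPath
  have hnil : ¬ p.Nil := Walk.not_nil_of_ne huw
  have hnbr : ∀ y ∈ p.support, (p.toSubgraph.neighborSet y).ncard = deg G y ∧
      (deg G y = 1 → y = u ∨ y = w) := by
    intro y hy
    have hle : (p.toSubgraph.neighborSet y).ncard ≤ deg G y :=
      Set.ncard_le_ncard (p.toSubgraph.neighborSet_subset y) (Set.toFinite _)
    obtain ⟨i, rfl, hi⟩ := Walk.mem_support_iff_exists_getVert.1 hy
    rcases Nat.eq_zero_or_pos i with rfl | h0
    · rw [Walk.getVert_zero, hp.neighborSet_toSubgraph_startpoint hnil, hu]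
      simp
    · rcases hi.lt_or_eq with hlt | rfl
      · have h2 := hp.ncard_neighborSet_toSubgraph_internal_eq_two h0.ne' hlt
        have := hdeg (p.getVert i)
        exact ⟨by omega, by omega⟩
      · rw [Walk.getVert_length, hp.neighborSet_toSubgraph_endpoint hnil, hw]
        simp
  have hmem : x ∈ {y | y ∈ p.support} := by
    refine mem_of_reachable (fun y hy z hyz => ?_) hrx p.start_mem_support
    have heq : p.toSubgraph.neighborSet y = G.neighborSet y :=
      Set.eq_of_subset_of_ncard_le (p.toSubgraph.neighborSet_subset y) (hnbr y hy).1.ge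
        (Set.toFinite _)
    have hz : z ∈ p.toSubgraph.neighborSet y := heq ▸ hyz
    exact p.mem_verts_toSubgraph.1 (p.toSubgraph.edge_vert (Subgraph.Adj.symm hz))
  rcases (hnbr x hmem).2 hx with h | h
  · exact absurd h.symm hux
  · exact h.symm

/-! ### Transport along embeddings -/

lemma neighborSet_map (f : V ↪ W) (v : V) :
    (G.map f).neighborSet (f v) = f '' G.neighborSet v := by
  ext w
  simp only [mem_neighborSet, map_adj, Set.mem_image]
  constructor
  · rintro ⟨x, y, h, hx, rfl⟩
    exact ⟨y, f.injective hx ▸ h, rfl⟩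
  · rintro ⟨y, h, rfl⟩
    exact ⟨v, y, h, rfl, rfl⟩

lemma deg_map (f : V ↪ W) (v : V) : deg (G.map f) (f v) = deg G v := by
  rw [deg, neighborSet_map, Set.ncard_image_of_injective _ f.injective, deg]

lemma deg_map_of_notMem_range (f : V ↪ W) {w : W} (hw : w ∉ Set.range f) :
    deg (G.map f) w = 0 := by
  have : (G.map f).neighborSet w = ∅ := by
    ext x
    simp only [mem_neighborSet, map_adj, Set.mem_empty_iff_false, iff_false]
    rintro ⟨u, v, -, hu, -⟩
    exact hw ⟨u, hu⟩
  rw [deg, this, Set.ncard_empty]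

lemma reachable_map_iff (f : V ↪ W) {u v : V} :
    (G.map f).Reachable (f u) (f v) ↔ G.Reachable u v := by
  refine ⟨fun h => ?_, fun h => h.map (Embedding.map f G).toHom⟩
  have : f v ∈ {w | ∃ x, f x = w ∧ G.Reachable u x} := by
    refine mem_of_reachable ?_ h ⟨u, rfl, Reachable.refl u⟩
    rintro _ ⟨x, rfl, hx⟩ y hy
    obtain ⟨x', y', hxy, hx', rfl⟩ := (map_adj _ _ _ _).1 hy
    rw [f.injective hx'] at hxy
    exact ⟨y', rfl, hx.trans hxy.reachable⟩
  obtain ⟨x, hx, hux⟩ := this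
  rwa [f.injective hx] at hux

lemma reachesEnds_map_iff (f : V ↪ W) : ReachesEnds (G.map f) ↔ ReachesEnds G := by
  constructor
  · intro h v
    obtain ⟨w, hw, hd⟩ := h (f v)
    by_cases hwr : w ∈ Set.range f
    · obtain ⟨x, rfl⟩ := hwr
      exact ⟨x, (reachable_map_iff f).1 hw, by rwa [deg_map] at hd⟩
    · by_cases hne : f v = w
      · exact absurd ⟨v, hne⟩ hwr
      · obtain ⟨x, hx⟩ := exists_adj_of_reachable_ne hw.symm (Ne.symm hne)
        obtain ⟨x', y', -, hx', -⟩ := (map_adj _ _ _ _).1 hx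
        exact absurd ⟨x', hx'⟩ hwr
  · intro h w
    by_cases hwr : w ∈ Set.range f
    · obtain ⟨x, rfl⟩ := hwr
      obtain ⟨y, hy, hd⟩ := h x
      exact ⟨f y, (reachable_map_iff f).2 hy, by rwa [deg_map]⟩
    · exact ⟨w, Reachable.refl w, by rw [deg_map_of_notMem_range f hwr]; omega⟩

lemma isSingleCycle_map_iff (f : V ↪ W) : IsSingleCycle (G.map f) ↔ IsSingleCycle G := by
  have key : ∀ w, deg (G.map f) w ≠ 0 → ∃ v, f v = w := fun w hw => by
    by_contra h
    exact hw (deg_map_of_notMem_range f h)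
  constructor
  · rintro ⟨⟨w, hw⟩, h2, hr⟩
    obtain ⟨v, rfl⟩ := key w hw
    rw [deg_map] at hw
    refine ⟨⟨v, hw⟩, fun x => ?_, fun x y hx hy => (reachable_map_iff f).1 (hr _ _ ?_ ?_)⟩
    · have := h2 (f x)
      rwa [deg_map] at this
    · rwa [deg_map]
    · rwa [deg_map]
  · rintro ⟨⟨w, hw⟩, h2, hr⟩
    refine ⟨⟨f w, by rwa [deg_map]⟩, fun x => ?_, fun x y hx hy => ?_⟩
    · by_cases hx : deg (G.map f) x = 0
      · exact Or.inl hx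
      · obtain ⟨v, rfl⟩ := key x hx
        rw [deg_map]
        exact h2 v
    · obtain ⟨v, rfl⟩ := key x hx
      obtain ⟨v', rfl⟩ := key y hy
      rw [deg_map] at hx hy
      exact (reachable_map_iff f).2 (hr _ _ hx hy)

/-! ### Cycle graphs and Hamiltonian cycles -/

lemma deg_removeIsolated (v : G.support) : deg (removeIsolated G) v = deg G v := by
  rw [deg, deg, ← Set.ncard_image_of_injective _ Subtype.val_injective]
  congr 1
  ext w
  constructor
  · rintro ⟨x, hx, rfl⟩
    exact hx
  · intro hw
    exact ⟨⟨w, v, hw.symm⟩, hw, rfl⟩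

lemma reachable_removeIsolated {v w : V} (h : G.Reachable v w) (hv : v ∈ G.support)
    (hw : w ∈ G.support) : (removeIsolated G).Reachable ⟨v, hv⟩ ⟨w, hw⟩ := by
  have : w ∈ {x | ∃ hx : x ∈ G.support, (removeIsolated G).Reachable ⟨v, hv⟩ ⟨x, hx⟩} := by
    refine mem_of_reachable ?_ h ⟨hv, Reachable.refl _⟩
    rintro x ⟨hx, hr⟩ y hxy
    have hy : y ∈ G.support := ⟨x, hxy.symm⟩
    have hadj : (removeIsolated G).Adj ⟨x, hx⟩ ⟨y, hy⟩ := hxy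
    exact ⟨hy, hr.trans hadj.reachable⟩
  exact this.2

theorem isCycleGraph_removeIsolated_iff [Finite V] :
    IsCycleGraph (removeIsolated G) ↔ IsSingleCycle G := by
  classical
  have hmem : ∀ v, deg G v ≠ 0 ↔ v ∈ G.support := fun v => deg_ne_zero_iff (Set.toFinite _)
  constructor
  · rintro ⟨v, p, hp, htop⟩
    have hsupp : ∀ x, x ∈ p.support := fun x => by
      rw [← p.mem_verts_toSubgraph, htop]
      trivial
    refine ⟨⟨v, (hmem _).2 v.2⟩, fun x => ?_, fun x y hx hy => ?_⟩
    · by_cases hx : deg G x = 0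
      · exact Or.inl hx
      · right
        have h2 := hp.ncard_neighborSet_toSubgraph_eq_two (hsupp ⟨x, (hmem x).1 hx⟩)
        rw [htop] at h2
        rw [← deg_removeIsolated ⟨x, (hmem x).1 hx⟩, ← h2]
        rfl
    · have h1 := (p.takeUntil _ (hsupp ⟨x, (hmem x).1 hx⟩)).reachable
      have h2 := (p.takeUntil _ (hsupp ⟨y, (hmem y).1 hy⟩)).reachable
      exact (h1.symm.trans h2).map (Embedding.induce G.support).toHom
  · rintro ⟨⟨v, hv⟩, h2, hr⟩
    have h2' : ∀ x, deg (removeIsolated G) x = 2 := fun x => by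
      rw [deg_removeIsolated]
      exact (h2 x).resolve_left ((hmem _).2 x.2)
    have hcyc : (removeIsolated G).IsCycles := fun x _ => h2' x
    have hv' := (hmem v).1 hv
    obtain ⟨p, hp, hverts⟩ := hcyc.exists_cycle_toSubgraph_verts_eq_connectedComponentSupp
      (c := (removeIsolated G).connectedComponentMk ⟨v, hv'⟩) rfl
      (by
        apply Set.nonempty_of_ncard_ne_zero
        change deg (removeIsolated G) _ ≠ 0
        rw [h2']
        decide)
    have hall : ∀ x, x ∈ p.toSubgraph.verts := fun x => by
      rw [hverts, ConnectedComponent.mem_supp_iff, ConnectedComponent.eq]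
      exact reachable_removeIsolated (hr _ _ ((hmem _).2 x.2) hv) x.2 hv'
    refine ⟨_, p, hp, Subgraph.ext (Set.eq_univ_of_forall hall) ?_⟩
    funext x y
    refine propext ⟨fun h => h.adj_sub, fun h => ?_⟩
    exact toSubgraph_adj_of_isCycle hp (p.mem_verts_toSubgraph.1 (hall x)) (h2' x).le h

/-- A finite two-regular graph has a cycle through the whole component of any vertex; connectedness
makes this cycle Hamiltonian, and regularity makes it use every edge of `H`. -/
theorem mem_hamiltonianCycles_iff [Finite V] [DecidableEq V] [Nonempty V] {H : G.Subgraph} :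
    H ∈ hamiltonianCycles G ↔
      (∀ v, deg H.spanningCoe v = 2) ∧ ∀ v w, H.spanningCoe.Reachable v w := by
  constructor
  · rintro ⟨v, p, hp, rfl⟩
    refine ⟨fun x => hp.isCycle.ncard_neighborSet_toSubgraph_eq_two (hp.mem_support x),
      fun x y => ?_⟩
    have hx := p.mem_verts_toSubgraph.2 (hp.mem_support x)
    have hy := p.mem_verts_toSubgraph.2 (hp.mem_support y)
    exact (p.toSubgraph_connected.preconnected ⟨x, hx⟩ ⟨y, hy⟩).map
      (⟨Subtype.val, fun h => h⟩ : p.toSubgraph.coe →g p.toSubgraph.spanningCoe)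
  · rintro ⟨h2, hr⟩
    obtain ⟨v⟩ := ‹Nonempty V›
    have hcyc : H.spanningCoe.IsCycles := fun x _ => h2 x
    have hne : ∀ x, (H.spanningCoe.neighborSet x).Nonempty := fun x => by
      apply Set.nonempty_of_ncard_ne_zero
      change deg H.spanningCoe _ ≠ 0
      rw [h2]
      decide
    obtain ⟨p, hp, hverts⟩ := hcyc.exists_cycle_toSubgraph_verts_eq_connectedComponentSupp
      (c := H.spanningCoe.connectedComponentMk v) rfl (hne v)
    have hall : ∀ x, x ∈ p.support := fun x => by
      rw [← p.mem_verts_toSubgraph, hverts, ConnectedComponent.mem_supp_iff, ConnectedComponent.eq]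
      exact hr x v
    have hall' : ∀ x, x ∈ (p.mapLe H.spanningCoe_le).support := fun x => by
      simpa using hall x
    have hq : (p.mapLe H.spanningCoe_le).IsCycle := hp.mapLe H.spanningCoe_le
    refine ⟨v, p.mapLe H.spanningCoe_le, ?_, Subgraph.ext ?_ ?_⟩
    · rw [Walk.isHamiltonianCycle_iff_isCycle_and_support_count_tail_eq_one]
      refine ⟨hq, fun x => List.count_eq_one_of_mem hq.support_nodup ?_⟩
      have hx := hall' x
      rw [Walk.mem_support_iff] at hx
      rcases hx with rfl | hx
      · exact Walk.end_mem_tail_support hq.not_nil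
      · exact hx
    · ext x
      simp only [Walk.mem_verts_toSubgraph, hall' x, true_iff]
      obtain ⟨y, hy⟩ := hne x
      exact H.edge_vert hy
    · funext x y
      rw [Walk.adj_toSubgraph_mapLe]
      exact propext ⟨fun h => h.adj_sub,
        fun h => toSubgraph_adj_of_isCycle hp (hall x) (h2 x).le h⟩

end Graphs

end Necklace

namespace Necklace

open SimpleGraph

/-! ### Contracting paths to edges -/

section Contraction

variable {V : Type*} {H E : SimpleGraph V}

lemma finite_neighborSet_of_support (hH : H.support.Finite) (v : V) :
    (H.neighborSet v).Finite :=
  hH.subset fun _ hw => ⟨v, Adj.symm hw⟩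

/-- The graph that joins the two end vertices of every path component. -/
def pathContraction (H : SimpleGraph V) : SimpleGraph V where
  Adj x y := x ≠ y ∧ deg H x = 1 ∧ deg H y = 1 ∧ H.Reachable x y
  symm := ⟨fun _ _ h => ⟨h.1.symm, h.2.2.1, h.2.1, h.2.2.2.symm⟩⟩
  loopless := ⟨fun _ h => h.1 rfl⟩

lemma deg_pathContraction_of_deg_eq_one (hH : H.support.Finite) (hdeg : ∀ v, deg H v ≤ 2) {u : V}
    (hu : deg H u = 1) : deg (pathContraction H) u = 1 := by
  -- The vertex type may be infinite. Dropping isolated vertices leaves a finite graph, where the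
  -- uniqueness and parity lemmas apply.
  have : Finite H.support := hH
  have hf := finite_neighborSet_of_support hH
  have hdeg' : ∀ v, deg (removeIsolated H) v ≤ 2 := fun v => by
    rw [deg_removeIsolated]
    exact hdeg v
  have hmem : ∀ x, deg H x = 1 → x ∈ H.support := fun x hx =>
    (deg_ne_zero_iff (hf x)).1 (by omega)
  obtain ⟨w, huw, hw, hr⟩ := exists_ne_deg_eq_one hdeg' (u := ⟨u, hmem u hu⟩)
    (by rwa [deg_removeIsolated])
  rw [deg, Set.ncard_eq_one]
  refine ⟨w, Set.eq_singleton_iff_unique_mem.2 ⟨⟨fun h => huw (Subtype.ext h), hu, ?_, ?_⟩, ?_⟩⟩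
  · rwa [deg_removeIsolated] at hw
  · exact hr.map (Embedding.induce H.support).toHom
  · rintro x ⟨hux, -, hx, hrx⟩
    have := eq_of_reachable_of_deg_eq_one hdeg' (u := ⟨u, hmem u hu⟩) (x := ⟨x, hmem x hx⟩)
      (by rwa [deg_removeIsolated]) hw (by rwa [deg_removeIsolated]) huw
      (fun h => hux (congrArg Subtype.val h)) hr (reachable_removeIsolated hrx _ _)
    rw [this]

lemma deg_pathContraction_of_deg_ne_one {u : V} (hu : deg H u ≠ 1) :
    deg (pathContraction H) u = 0 := by
  have : (pathContraction H).neighborSet u = ∅ := by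
    ext x
    simp only [mem_neighborSet, Set.mem_empty_iff_false, iff_false]
    exact fun h => hu h.2.1
  rw [deg, this, Set.ncard_empty]

lemma deg_sup_of_disjoint {G G' : SimpleGraph V} {v : V} (hG : (G.neighborSet v).Finite)
    (hG' : (G'.neighborSet v).Finite) (hd : ∀ w, G.Adj v w → ¬ G'.Adj v w) :
    deg (G ⊔ G') v = deg G v + deg G' v := by
  have h : G.neighborSet v ∪ G'.neighborSet v = (G ⊔ G').neighborSet v := rfl
  have hdisj : Disjoint (G.neighborSet v) (G'.neighborSet v) := Set.disjoint_left.2 hd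
  rw [deg, deg, deg, ← Set.ncard_union_eq hdisj hG hG', h]

/-- `E` extends the graph `H` of maximum degree two at vertices of degree at most one, and every
edge of `E` contains a vertex isolated in `H`. -/
structure IsExtension (H E : SimpleGraph V) : Prop where
  finite_left : H.support.Finite
  finite_right : E.support.Finite
  deg_le_two : ∀ v, deg H v ≤ 2
  deg_le_one : ∀ x y, E.Adj x y → deg H x ≤ 1
  deg_eq_zero : ∀ x y, E.Adj x y → deg H x = 0 ∨ deg H y = 0

/-! ### Degrees, reachability and cycles under contraction of paths -/

namespace IsExtension

lemma finite_neighborSet_left (h : IsExtension H E) (v : V) : (H.neighborSet v).Finite :=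
  finite_neighborSet_of_support h.finite_left v

lemma finite_neighborSet_right (h : IsExtension H E) (v : V) : (E.neighborSet v).Finite :=
  finite_neighborSet_of_support h.finite_right v

lemma finite_neighborSet_sup (h : IsExtension H E) (v : V) : ((H ⊔ E).neighborSet v).Finite :=
  (h.finite_neighborSet_left v).union (h.finite_neighborSet_right v)

lemma finite_neighborSet_contraction (h : IsExtension H E) (v : V) :
    ((pathContraction H).neighborSet v).Finite :=
  h.finite_left.subset fun x hx => (deg_ne_zero_iff (h.finite_neighborSet_left x)).1
    (by have := hx.2.2.1; omega)

lemma finite_neighborSet_contraction_sup (h : IsExtension H E) (v : V) :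
    ((pathContraction H ⊔ E).neighborSet v).Finite :=
  (h.finite_neighborSet_contraction v).union (h.finite_neighborSet_right v)

lemma deg_sup (h : IsExtension H E) (v : V) : deg (H ⊔ E) v = deg H v + deg E v := by
  refine deg_sup_of_disjoint (h.finite_neighborSet_left v) (h.finite_neighborSet_right v) ?_
  intro w hH hE
  rcases h.deg_eq_zero v w hE with h0 | h0
  · exact not_adj_of_deg_eq_zero (h.finite_neighborSet_left v) h0 hH
  · exact not_adj_of_deg_eq_zero (h.finite_neighborSet_left w) h0 hH.symm

lemma deg_right_of_deg_eq_two (h : IsExtension H E) {v : V} (hv : deg H v = 2) :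
    deg E v = 0 := by
  by_contra hne
  obtain ⟨w, hw⟩ := (deg_ne_zero_iff (h.finite_neighborSet_right v)).1 hne
  have := h.deg_le_one v w hw
  omega

lemma deg_contraction_sup (h : IsExtension H E) (v : V) :
    deg (pathContraction H ⊔ E) v = deg (pathContraction H) v + deg E v := by
  refine deg_sup_of_disjoint (h.finite_neighborSet_contraction v) (h.finite_neighborSet_right v) ?_
  intro w hH hE
  have h1 := hH.2.1
  have h2 := hH.2.2.1
  rcases h.deg_eq_zero v w hE with h0 | h0 <;> omega

/-- The end of a path has one neighbour before contraction, on the path, and one after it, the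
opposite end; isolated vertices are untouched. -/
lemma deg_contraction_sup_of_le_one (h : IsExtension H E) {v : V} (hv : deg H v ≤ 1) :
    deg (pathContraction H ⊔ E) v = deg (H ⊔ E) v := by
  rw [h.deg_sup, h.deg_contraction_sup]
  by_cases h1 : deg H v = 1
  · rw [deg_pathContraction_of_deg_eq_one h.finite_left h.deg_le_two h1, h1]
  · rw [deg_pathContraction_of_deg_ne_one h1, show deg H v = 0 by omega]

lemma deg_contraction_sup_of_eq_two (h : IsExtension H E) {v : V} (hv : deg H v = 2) :
    deg (pathContraction H ⊔ E) v = 0 := by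
  rw [h.deg_contraction_sup, deg_pathContraction_of_deg_ne_one (by omega),
    h.deg_right_of_deg_eq_two hv]

lemma deg_le_one_of_contraction_ne_zero (h : IsExtension H E) {v : V}
    (hv : deg (pathContraction H ⊔ E) v ≠ 0) : deg H v ≤ 1 := by
  by_contra hcon
  have := h.deg_le_two v
  exact hv (h.deg_contraction_sup_of_eq_two (by omega))

lemma reachable_sup_of_contraction {x y : V}
    (hr : (pathContraction H ⊔ E).Reachable x y) : (H ⊔ E).Reachable x y := by
  refine mem_of_reachable (S := {z | (H ⊔ E).Reachable x z}) ?_ hr (Reachable.refl x)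
  rintro z hz w (hw | hw)
  · exact hz.trans (hw.2.2.2.mono le_sup_left)
  · exact hz.trans (Adj.reachable (Or.inr hw))

lemma reachable_contraction_of_left (h : IsExtension H E) {x y : V} (hx : deg H x ≤ 1)
    (hy : deg H y ≤ 1) (hr : H.Reachable x y) : (pathContraction H ⊔ E).Reachable x y := by
  by_cases hne : x = y
  · rw [hne]
  · have h1 := deg_ne_zero_of_reachable_ne (h.finite_neighborSet_left x) hr hne
    have h2 := deg_ne_zero_of_reachable_ne (h.finite_neighborSet_left y) hr.symm (Ne.symm hne)
    exact Adj.reachable (Or.inl ⟨hne, by omega, by omega, hr⟩)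

lemma reachable_contraction_iff (h : IsExtension H E) {x y : V} (hx : deg H x ≤ 1)
    (hy : deg H y ≤ 1) :
    (pathContraction H ⊔ E).Reachable x y ↔ (H ⊔ E).Reachable x y := by
  refine ⟨reachable_sup_of_contraction, fun hr => ?_⟩
  -- Here `w` is the latest vertex from which the walk can have continued inside `H` alone. Each
  -- edge of `E` resets it, and both ends of that edge survive the contraction.
  have : y ∈ {z | ∃ w, deg H w ≤ 1 ∧ (pathContraction H ⊔ E).Reachable x w ∧
      H.Reachable w z} := by
    refine mem_of_reachable ?_ hr ⟨x, hx, Reachable.refl x, Reachable.refl x⟩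
    rintro z ⟨w, hw, hxw, hwz⟩ z' (hz | hz)
    · exact ⟨w, hw, hxw, hwz.trans hz.reachable⟩
    · refine ⟨z', h.deg_le_one _ _ hz.symm, ?_, Reachable.refl z'⟩
      exact (hxw.trans (h.reachable_contraction_of_left hw (h.deg_le_one _ _ hz) hwz)).trans
        (Adj.reachable (Or.inr hz))
  obtain ⟨w, hw, hxw, hwy⟩ := this
  exact hxw.trans (h.reachable_contraction_of_left hw hy hwy)

/-- The assumption on `H` excludes cyclic components of `H`, which contraction would erase without
trace. Inner vertices of paths become isolated, so they satisfy the condition trivially on the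
contracted side and follow a path to its end on the other. -/
theorem reachesEnds_contraction_iff (h : IsExtension H E) (hH : ReachesEnds H) :
    ReachesEnds (pathContraction H ⊔ E) ↔ ReachesEnds (H ⊔ E) := by
  constructor
  · intro hG v
    obtain ⟨w, hvw, hw⟩ := hH v
    obtain ⟨u, hwu, hu⟩ := hG w
    have hu1 : deg H u ≤ 1 := by
      by_cases hne : u = w
      · rwa [hne]
      · exact h.deg_le_one_of_contraction_ne_zero
          (deg_ne_zero_of_reachable_ne (h.finite_neighborSet_contraction_sup u) hwu.symm hne)
    refine ⟨u, (hvw.mono le_sup_left).trans (reachable_sup_of_contraction hwu), ?_⟩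
    rwa [← h.deg_contraction_sup_of_le_one hu1]
  · intro hK v
    by_cases hv : deg H v = 2
    · exact ⟨v, Reachable.refl v, by rw [h.deg_contraction_sup_of_eq_two hv]; omega⟩
    · have hv2 := h.deg_le_two v
      obtain ⟨w, hvw, hw⟩ := hK v
      have hw1 : deg H w ≤ 1 := by
        rw [h.deg_sup] at hw
        omega
      exact ⟨w, (h.reachable_contraction_iff (by omega) hw1).2 hvw,
        by rwa [h.deg_contraction_sup_of_le_one hw1]⟩

theorem isSingleCycle_contraction_iff (h : IsExtension H E) (hH : ReachesEnds H)
    (hE : ∃ v, deg E v ≠ 0) :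
    IsSingleCycle (pathContraction H ⊔ E) ↔ IsSingleCycle (H ⊔ E) := by
  constructor
  · rintro ⟨⟨v, hv⟩, h2, hr⟩
    have key : ∀ x, deg (H ⊔ E) x ≠ 0 → ∃ w, (H ⊔ E).Reachable x w ∧
        deg (pathContraction H ⊔ E) w ≠ 0 := by
      intro x hx
      obtain ⟨w, hxw, hw⟩ := hH x
      refine ⟨w, hxw.mono le_sup_left, ?_⟩
      rw [h.deg_contraction_sup_of_le_one hw]
      by_cases hne : w = x
      · rwa [hne]
      · exact deg_ne_zero_of_reachable_ne (h.finite_neighborSet_sup w)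
          (hxw.mono le_sup_left).symm hne
    refine ⟨⟨v, ?_⟩, fun x => ?_, fun x y hx hy => ?_⟩
    · rwa [← h.deg_contraction_sup_of_le_one (h.deg_le_one_of_contraction_ne_zero hv)]
    · by_cases hx : deg H x = 2
      · rw [h.deg_sup, h.deg_right_of_deg_eq_two hx, hx]
        exact Or.inr rfl
      · have := h.deg_le_two x
        rw [← h.deg_contraction_sup_of_le_one (by omega)]
        exact h2 x
    · obtain ⟨x', hxx', hx'⟩ := key x hx
      obtain ⟨y', hyy', hy'⟩ := key y hy
      exact (hxx'.trans (reachable_sup_of_contraction (hr _ _ hx' hy'))).trans hyy'.symm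
  · rintro ⟨-, h2, hr⟩
    have key : ∀ x, deg (pathContraction H ⊔ E) x ≠ 0 →
        deg H x ≤ 1 ∧ deg (H ⊔ E) x ≠ 0 := fun x hx => by
      have h1 := h.deg_le_one_of_contraction_ne_zero hx
      exact ⟨h1, by rwa [← h.deg_contraction_sup_of_le_one h1]⟩
    refine ⟨?_, fun x => ?_, fun x y hx hy => ?_⟩
    · obtain ⟨v, hv⟩ := hE
      exact ⟨v, by rw [h.deg_contraction_sup]; omega⟩
    · by_cases hx : deg (pathContraction H ⊔ E) x = 0
      · exact Or.inl hx
      · rw [h.deg_contraction_sup_of_le_one (key x hx).1]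
        exact h2 x
    · exact (h.reachable_contraction_iff (key x hx).1 (key y hy).1).2
        (hr _ _ (key x hx).2 (key y hy).2)

/-- At vertices isolated in `H`, the graph and its contracted version have the same paths. -/
theorem pathContraction_contraction_adj_iff (h : IsExtension H E) {x y : V} (hx : deg H x = 0)
    (hy : deg H y = 0) :
    (pathContraction (pathContraction H ⊔ E)).Adj x y ↔ (pathContraction (H ⊔ E)).Adj x y := by
  change _ ∧ _ ∧ _ ∧ _ ↔ _ ∧ _ ∧ _ ∧ _
  rw [h.deg_contraction_sup_of_le_one (by omega), h.deg_contraction_sup_of_le_one (by omega),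
    h.reachable_contraction_iff (by omega) (by omega)]

lemma deg_contraction_le_two (h : IsExtension H E) (h2 : ∀ v, deg (H ⊔ E) v ≤ 2) (v : V) :
    deg (pathContraction H ⊔ E) v ≤ 2 := by
  by_cases hv : deg (pathContraction H ⊔ E) v = 0
  · omega
  · rw [h.deg_contraction_sup_of_le_one (h.deg_le_one_of_contraction_ne_zero hv)]
    exact h2 v

end IsExtension

end Contraction

end Necklace

namespace Necklace

open SimpleGraph

namespace TwoColumn

variable {a b : ℕ}

/-! ### Blocks placed at a position of the number line -/

/-- The embedding `u ↦ c + u` of `{0, …, m - 1}` into the naturals. -/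
def shiftEmb (c m : ℕ) : Fin m ↪ ℕ where
  toFun u := c + u
  inj' _ _ h := Fin.ext (Nat.add_left_cancel h)

@[simp] lemma shiftEmb_apply (c m : ℕ) (u : Fin m) : shiftEmb c m u = c + u := rfl

/-- The graph of `B` with its vertex `u` placed at `c + u`. -/
def placed (c : ℕ) (B : TwoColumn b) : SimpleGraph ℕ := B.graph.map (shiftEmb c _)

/-- The glued graph with its vertex `u` placed at `c + u`. -/
def glueFrom (c : ℕ) (Bs : List (TwoColumn b)) : SimpleGraph ℕ where
  Adj x y := ∃ u v, (glue Bs).Adj u v ∧ x = c + u ∧ y = c + v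
  symm := ⟨fun _ _ ⟨u, v, h, hx, hy⟩ => ⟨v, u, h.symm, hy, hx⟩⟩
  loopless := ⟨fun _ ⟨_, _, h, hx, hy⟩ => h.ne (Nat.add_left_cancel (hx.symm.trans hy))⟩

lemma placed_adj {c : ℕ} {B : TwoColumn b} {x y : ℕ} :
    (placed c B).Adj x y ↔ ∃ u v, B.graph.Adj u v ∧ x = c + u ∧ y = c + v := by
  rw [placed, map_adj]
  simp only [shiftEmb_apply, eq_comm]

lemma glueFrom_zero (Bs : List (TwoColumn b)) : glueFrom 0 Bs = glue Bs := by
  ext x y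
  simp [glueFrom]

lemma glueFrom_nil (c : ℕ) : glueFrom c ([] : List (TwoColumn b)) = ⊥ := by
  ext x y
  simp only [glueFrom, bot_adj, iff_false]
  rintro ⟨u, v, ⟨j, -⟩, -⟩
  exact j.elim0

lemma glueFrom_cons (c : ℕ) (B : TwoColumn b) (Bs : List (TwoColumn b)) :
    glueFrom c (B :: Bs) = placed c B ⊔ glueFrom (c + b) Bs := by
  ext x y
  rw [sup_adj, placed_adj]
  constructor
  · rintro ⟨x', y', ⟨j, u, v, h, rfl, rfl⟩, rfl, rfl⟩
    obtain ⟨j, hj⟩ := j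
    cases j with
    | zero => exact Or.inl ⟨u, v, h, by simp, by simp⟩
    | succ j =>
      refine Or.inr ⟨j * b + u, j * b + v,
        ⟨⟨j, Nat.lt_of_succ_lt_succ hj⟩, u, v, h, rfl, rfl⟩, ?_, ?_⟩ <;>
      · simp only
        ring
  · rintro (⟨u, v, h, rfl, rfl⟩ | ⟨x', y', ⟨⟨j, hj⟩, u, v, h, rfl, rfl⟩, rfl, rfl⟩)
    · exact ⟨u, v, ⟨⟨0, Nat.zero_lt_succ _⟩, u, v, h, by simp, by simp⟩, rfl, rfl⟩
    · refine ⟨(j + 1) * b + u, (j + 1) * b + v,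
        ⟨⟨j + 1, Nat.succ_lt_succ hj⟩, u, v, h, rfl, rfl⟩, ?_, ?_⟩ <;>
      · simp only
        ring

lemma deg_placed (c : ℕ) (B : TwoColumn b) (u : Fin (b + B.rightLen)) :
    deg (placed c B) (c + u) = deg B.graph u :=
  deg_map (shiftEmb c _) u

lemma deg_placed_left (c : ℕ) (B : TwoColumn b) (i : Fin b) :
    deg (placed c B) (c + i) = deg B.graph (B.left i) :=
  deg_placed c B (B.left i)

lemma deg_placed_right (c : ℕ) (B : TwoColumn b) (i : Fin B.rightLen) :
    deg (placed c B) (c + b + i) = deg B.graph (B.right i) := by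
  rw [add_assoc]
  exact deg_placed c B (B.right i)

lemma placed_adj_lt {c : ℕ} {B : TwoColumn b} {x y : ℕ} (h : (placed c B).Adj x y) :
    c ≤ x ∧ x < c + b + B.rightLen := by
  obtain ⟨u, v, -, rfl, -⟩ := placed_adj.1 h
  have := u.2
  omega

lemma finite_support_of_lt {G : SimpleGraph ℕ} (m : ℕ) (h : ∀ x y, G.Adj x y → x < m) :
    G.support.Finite :=
  (Set.finite_lt_nat m).subset fun x ⟨y, hxy⟩ => h x y hxy

lemma deg_eq_zero_of_not_adj {G : SimpleGraph ℕ} {x : ℕ} (h : ∀ y, ¬ G.Adj x y) :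
    deg G x = 0 := by
  rw [deg, Set.ncard_eq_zero (by
    rw [Set.eq_empty_of_forall_notMem (s := G.neighborSet x) h]; exact Set.finite_empty)]
  exact Set.eq_empty_of_forall_notMem h

lemma finite_support_placed (c : ℕ) (B : TwoColumn b) : (placed c B).support.Finite :=
  finite_support_of_lt _ fun _ _ h => (placed_adj_lt h).2

lemma deg_placed_le_two {c : ℕ} {B : TwoColumn b} (hB : ∀ v, deg B.graph v ≤ 2) (x : ℕ) :
    deg (placed c B) x ≤ 2 := by
  by_cases hx : c ≤ x ∧ x < c + b + B.rightLen
  · obtain ⟨u, rfl⟩ := Nat.exists_eq_add_of_le hx.1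
    rw [deg_placed c B ⟨u, by omega⟩]
    exact hB _
  · rw [deg_eq_zero_of_not_adj fun y h => hx (placed_adj_lt h)]
    omega

/-- Blocks without edges in the left column, in terms of the placed graph. -/
lemma NoLeftEdge.le_of_placed_adj {c : ℕ} {B : TwoColumn b} (hB : B.NoLeftEdge) {x y : ℕ}
    (h : (placed c B).Adj x y) : c + b ≤ x ∨ c + b ≤ y := by
  obtain ⟨u, v, huv, rfl, rfl⟩ := placed_adj.1 h
  by_contra! hcon
  exact hB ⟨u, by omega⟩ ⟨v, by omega⟩ huv

lemma compatible_iff {B B' : TwoColumn b} (hB : B.rightLen = b) (hB' : B'.NoLeftEdge) :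
    B.Compatible B' ↔
      ∀ i : Fin b, deg B.graph (B.right (Fin.cast hB.symm i)) + deg B'.graph (B'.left i) = 2 := by
  rw [Compatible, and_iff_right hB]
  refine forall_congr' fun i => ?_
  have h0 : glue [B, B'] = placed 0 B ⊔ placed b B' := by
    rw [← glueFrom_zero, glueFrom_cons, glueFrom_cons, glueFrom_nil, sup_bot_eq, zero_add]
  have h1 := deg_placed_right 0 B (Fin.cast hB.symm i)
  rw [zero_add, Fin.val_cast] at h1
  rw [h0, deg_sup_of_disjoint (finite_neighborSet_of_support (finite_support_placed _ _) _)
    (finite_neighborSet_of_support (finite_support_placed _ _) _), h1, deg_placed_left]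
  -- The two blocks share no edge: those of `B` stay below `2 * b`, while each edge of `B'` has an
  -- end at or beyond it.
  intro w hw hw'
  have h2 := (placed_adj_lt hw.symm).2
  have := i.2
  rcases hB'.le_of_placed_adj hw' with h | h <;> omega

lemma pathEnds_eq (c : ℕ) (H : TwoColumn b) :
    H.pathEnds = {e | ∃ i j : Fin b, e = s(i, j) ∧
      (pathContraction (placed c H)).Adj (c + b + i) (c + b + j)} := by
  ext e
  constructor
  · rintro ⟨i, j, u, v, p, rfl, hu, hv, hp, hlen, hdu, hdv⟩
    refine ⟨i, j, rfl, ?_⟩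
    rw [add_assoc, add_assoc, ← hu, ← hv]
    refine ⟨fun h => ?_, by rwa [deg_placed], by rwa [deg_placed],
      (reachable_map_iff (shiftEmb c _)).2 p.reachable⟩
    have : u = v := Fin.ext (Nat.add_left_cancel h)
    subst this
    exact hlen.ne' (Walk.length_eq_zero_iff.2 (Walk.isPath_iff_nil.1 hp))
  · rintro ⟨i, j, rfl, hne, hi, hj, hr⟩
    -- A row `i < b` may lie beyond a short right column; such a number is isolated, so degree one
    -- forces a genuine vertex.
    have key : ∀ i : Fin b, deg (placed c H) (c + b + i) = 1 → b + (i : ℕ) < b + H.rightLen := by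
      intro i hi
      obtain ⟨w, hw⟩ := (deg_ne_zero_iff (finite_neighborSet_of_support
        (finite_support_placed c H) _)).1 (by rw [hi]; decide)
      have := (placed_adj_lt hw).2
      omega
    let u : Fin (b + H.rightLen) := ⟨b + i, key i hi⟩
    let v : Fin (b + H.rightLen) := ⟨b + j, key j hj⟩
    have hu : c + b + (i : ℕ) = c + (u : ℕ) := add_assoc _ _ _
    have hv : c + b + (j : ℕ) = c + (v : ℕ) := add_assoc _ _ _
    rw [hu, deg_placed] at hi
    rw [hv, deg_placed] at hj
    rw [hu, hv] at hr hne
    obtain ⟨p, hp⟩ := ((reachable_map_iff (shiftEmb c _)).1 hr).exists_isPath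
    refine ⟨i, j, u, v, p, rfl, rfl, rfl, hp, ?_, hi, hj⟩
    by_contra hlen
    exact hne (by rw [Walk.eq_of_length_eq_zero (p := p) (by omega)])

/-! ### The state reached after a sequence of blocks -/

/-- `H` is a graph on the columns below `c + b` that arises by gluing an initial segment of a walk
ending in `(B, L)`; its last column starts at `c`. -/
structure IsState (a c : ℕ) (H : SimpleGraph ℕ) (B : TwoColumn b) (L : Set (Sym2 (Fin b))) :
    Prop where
  rightLen : B.rightLen = b
  adj_lt : ∀ x y, H.Adj x y → x < c + b
  adj_abs : ∀ x y, H.Adj x y → |(x : ℤ) - y| = a ∨ |(x : ℤ) - y| = b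
  deg_eq_two : ∀ x < c, deg H x = 2
  deg_le_two : ∀ x, deg H x ≤ 2
  deg_right : ∀ i : Fin b, deg H (c + i) = deg B.graph (B.right (Fin.cast rightLen.symm i))
  reachesEnds : ReachesEnds H
  label : L = {e | ∃ i j : Fin b, e = s(i, j) ∧ (pathContraction H).Adj (c + i) (c + j)}

lemma IsPreBlock.placed_adj_abs {c : ℕ} {B : TwoColumn b} (hB : B.IsPreBlock a) {x y : ℕ}
    (h : (placed c B).Adj x y) : |(x : ℤ) - y| = a ∨ |(x : ℤ) - y| = b := by
  obtain ⟨u, v, huv, rfl, rfl⟩ := placed_adj.1 h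
  have := (hB.1 huv).2
  push_cast
  rwa [add_sub_add_left_eq_sub]

theorem isState_start {B : TwoColumn b} (hB : B.IsStart a) (hac : B.graph.IsAcyclic) :
    IsState a b (placed 0 B) B B.pathEnds where
  rightLen := hB.2.1
  adj_lt x y h := by
    have := (placed_adj_lt h).2
    rw [hB.2.1] at this
    omega
  adj_abs x y h := hB.1.placed_adj_abs h
  deg_eq_two x hx := by
    rw [← hB.2.2 ⟨x, hx⟩, ← deg_placed_left 0, zero_add]
  deg_le_two := deg_placed_le_two hB.1.2
  deg_right i := by
    have := deg_placed_right 0 B (Fin.cast hB.2.1.symm i)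
    rwa [zero_add] at this
  reachesEnds := (reachesEnds_map_iff _).2 ((isAcyclic_iff_reachesEnds hB.1.2).1 hac)
  label := by
    rw [pathEnds_eq 0, zero_add]

/-! ### Appending a block to a state -/

namespace IsState

variable {c : ℕ} {H : SimpleGraph ℕ} {B B' : TwoColumn b} {L : Set (Sym2 (Fin b))}

lemma deg_eq_zero (h : IsState a c H B L) {x : ℕ} (hx : c + b ≤ x) : deg H x = 0 :=
  deg_eq_zero_of_not_adj fun y hy => by have := h.adj_lt x y hy; omega

lemma deg_add (h : IsState a c H B L) (hB' : B'.NoLeftEdge) (hc : B.Compatible B') (i : Fin b) :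
    deg H (c + i) + deg (placed c B') (c + i) = 2 := by
  rw [h.deg_right, deg_placed_left]
  exact (compatible_iff h.rightLen hB').1 hc i

/-- By compatibility the degrees in `H` and in `B'` add up to two on the shared column, so a vertex
there with an edge of `B'` has degree at most one in `H`. Since `B'` has no left edges, each of its
edges has an end in the new column, where `H` is isolated. -/
theorem isExtension (h : IsState a c H B L) (hB' : B'.NoLeftEdge) (hc : B.Compatible B') :
    IsExtension H (placed c B') where
  finite_left := finite_support_of_lt _ h.adj_lt
  finite_right := finite_support_placed _ _
  deg_le_two := h.deg_le_two
  deg_le_one x y hxy := by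
    by_cases hx : x < c + b
    · have hcx := (placed_adj_lt hxy).1
      have h1 := h.deg_add hB' hc ⟨x - c, by omega⟩
      simp only [Nat.add_sub_cancel' hcx] at h1
      have h2 := (deg_ne_zero_iff (finite_neighborSet_of_support
        (finite_support_placed c B') x)).2 ⟨y, hxy⟩
      omega
    · rw [h.deg_eq_zero (by omega)]
      omega
  deg_eq_zero x y hxy :=
    (hB'.le_of_placed_adj hxy).imp h.deg_eq_zero h.deg_eq_zero

lemma mem_column_of_deg_eq_one (h : IsState a c H B L) {x : ℕ} (hx : deg H x = 1) :
    c ≤ x ∧ x < c + b := by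
  constructor
  · by_contra hcon
    have := h.deg_eq_two x (by omega)
    omega
  · by_contra hcon
    have := h.deg_eq_zero (x := x) (by omega)
    omega

/-- This identifies the added label edges with contracted paths. All path ends of `H` lie in its
last column, as earlier vertices have degree two, so no pair of ends is missed by `L`. -/
theorem placed_augment (h : IsState a c H B L) :
    placed c (B'.augment L) = pathContraction H ⊔ placed c B' := by
  ext x y
  rw [sup_adj, placed_adj, placed_adj]
  constructor
  · rintro ⟨u, v, huv | huv, rfl, rfl⟩
    · exact Or.inr ⟨u, v, huv, rfl, rfl⟩
    · left
      obtain ⟨i, j, hij, rfl, rfl⟩ := (map_adj _ _ _ _).1 huv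
      have hmem := ((fromEdgeSet_adj _).1 hij).1
      rw [h.label] at hmem
      obtain ⟨i', j', he, hadj⟩ := hmem
      rcases Sym2.eq_iff.1 he with ⟨rfl, rfl⟩ | ⟨rfl, rfl⟩
      · exact hadj
      · exact hadj.symm
  · rintro (hxy | ⟨u, v, huv, rfl, rfl⟩)
    · obtain ⟨hcx, hxb⟩ := h.mem_column_of_deg_eq_one hxy.2.1
      obtain ⟨hcy, hyb⟩ := h.mem_column_of_deg_eq_one hxy.2.2.1
      obtain ⟨i, rfl⟩ := Nat.exists_eq_add_of_le hcx
      obtain ⟨j, rfl⟩ := Nat.exists_eq_add_of_le hcy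
      let i' : Fin b := ⟨i, by omega⟩
      let j' : Fin b := ⟨j, by omega⟩
      refine ⟨Fin.castAdd _ i', Fin.castAdd _ j', Or.inr ?_, rfl, rfl⟩
      refine (map_adj _ _ _ _).2 ⟨i', j', (fromEdgeSet_adj _).2 ⟨?_, ?_⟩, rfl, rfl⟩
      · rw [h.label]
        exact ⟨i', j', rfl, hxy⟩
      · intro hij
        exact hxy.ne (congrArg (fun z : Fin b => c + (z : ℕ)) hij)
    · exact ⟨u, v, Or.inl huv, rfl, rfl⟩

lemma deg_sup_lt (h : IsState a c H B L) (hB' : B'.NoLeftEdge) (hc : B.Compatible B') {x : ℕ}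
    (hx : x < c + b) : deg (H ⊔ placed c B') x = 2 := by
  have hext := h.isExtension hB' hc
  rw [hext.deg_sup]
  by_cases hxc : x < c
  · rw [hext.deg_right_of_deg_eq_two (h.deg_eq_two x hxc), h.deg_eq_two x hxc]
  · have := h.deg_add hB' hc ⟨x - c, by omega⟩
    rwa [show c + (x - c) = x by omega] at this

lemma deg_sup_right (h : IsState a c H B L) (hB' : B'.NoLeftEdge) (hc : B.Compatible B')
    (i : Fin B'.rightLen) :
    deg (H ⊔ placed c B') (c + b + i) = deg B'.graph (B'.right i) := by
  rw [(h.isExtension hB' hc).deg_sup, h.deg_eq_zero (by omega), zero_add, deg_placed_right]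

lemma sup_adj_lt (h : IsState a c H B L) {x y : ℕ} (hxy : (H ⊔ placed c B').Adj x y) :
    x < c + b + B'.rightLen := by
  rcases hxy with hxy | hxy
  · have := h.adj_lt _ _ hxy
    omega
  · exact (placed_adj_lt hxy).2

lemma sup_adj_abs (h : IsState a c H B L) (hB' : B'.IsPreBlock a) {x y : ℕ}
    (hxy : (H ⊔ placed c B').Adj x y) : |(x : ℤ) - y| = a ∨ |(x : ℤ) - y| = b :=
  hxy.elim (h.adj_abs _ _) hB'.placed_adj_abs

lemma deg_sup_le_two (h : IsState a c H B L) (hpre : B'.IsPreBlock a) (hB' : B'.NoLeftEdge)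
    (hc : B.Compatible B') (x : ℕ) : deg (H ⊔ placed c B') x ≤ 2 := by
  by_cases hx : x < c + b
  · rw [h.deg_sup_lt hB' hc hx]
  · rw [(h.isExtension hB' hc).deg_sup, h.deg_eq_zero (by omega), zero_add]
    exact deg_placed_le_two hpre.2 x

theorem isAcyclic_augment_iff (h : IsState a c H B L) (hpre : B'.IsPreBlock a)
    (hB' : B'.NoLeftEdge) (hc : B.Compatible B') :
    (B'.augment L).graph.IsAcyclic ↔ ReachesEnds (H ⊔ placed c B') := by
  have hext := h.isExtension hB' hc
  have hdeg : ∀ v, deg (B'.augment L).graph v ≤ 2 := fun v => by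
    rw [← deg_placed c, h.placed_augment]
    exact hext.deg_contraction_le_two (h.deg_sup_le_two hpre hB' hc) _
  rw [isAcyclic_iff_reachesEnds hdeg, ← hext.reachesEnds_contraction_iff h.reachesEnds,
    ← h.placed_augment, placed, reachesEnds_map_iff]

theorem isCycleGraph_augment_iff (h : IsState a c H B L)
    (hB' : B'.IsEnd a) (hc : B.Compatible B') :
    IsCycleGraph (removeIsolated (B'.augment L).graph) ↔ IsSingleCycle (H ⊔ placed c B') := by
  have hext := h.isExtension hB'.2.2.2.2 hc
  have hE : ∃ v, deg (placed c B') v ≠ 0 := by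
    have h1 := deg_placed_right c B' ⟨0, hB'.2.1⟩
    rw [hB'.2.2.2.1] at h1
    exact ⟨_, by rw [h1]; decide⟩
  rw [isCycleGraph_removeIsolated_iff, ← hext.isSingleCycle_contraction_iff h.reachesEnds hE,
    ← h.placed_augment, placed, isSingleCycle_map_iff]

/-- The new label is computed from `B'.augment L`, that is, after contraction. It agrees with the
label of the full glued graph because the new right column is isolated in `H`. -/
theorem step (h : IsState a c H B L) (hpre : B'.IsPreBlock a) (hlen : B'.rightLen = b)
    (hB' : B'.NoLeftEdge) (hc : B.Compatible B') (hr : ReachesEnds (H ⊔ placed c B')) :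
    IsState a (c + b) (H ⊔ placed c B') B' (B'.augment L).pathEnds where
  rightLen := hlen
  adj_lt x y hxy := by
    have := h.sup_adj_lt hxy
    omega
  adj_abs x y hxy := h.sup_adj_abs hpre hxy
  deg_eq_two x hx := h.deg_sup_lt hB' hc hx
  deg_le_two := h.deg_sup_le_two hpre hB' hc
  deg_right i := h.deg_sup_right hB' hc (Fin.cast hlen.symm i)
  reachesEnds := hr
  label := by
    rw [pathEnds_eq c, h.placed_augment]
    ext e
    refine exists_congr fun i => exists_congr fun j => and_congr_right fun _ => ?_
    exact (h.isExtension hB' hc).pathContraction_contraction_adj_iff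
      (h.deg_eq_zero (by omega)) (h.deg_eq_zero (by omega))

end IsState

end TwoColumn

end Necklace

namespace Necklace

open SimpleGraph TwoColumn

variable {a b : ℕ}

/-- Hamiltonian cycles of `G_{a,b}(n)`, as graphs on the naturals. -/
structure IsHamGraph (a b n : ℕ) (K : SimpleGraph ℕ) : Prop where
  adj_lt : ∀ x y, K.Adj x y → x < n
  adj_abs : ∀ x y, K.Adj x y → |(x : ℤ) - y| = a ∨ |(x : ℤ) - y| = b
  deg_eq_two : ∀ x < n, deg K x = 2
  reachable : ∀ x < n, ∀ y < n, K.Reachable x y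

/-! ### From walks to Hamiltonian cycles -/

/-- The blocks of all vertices of a walk but the first. -/
def laterBlocks {u t : DVertex a b} (p : (necklaceDigraph a b).Walk u t) : List (TwoColumn b) :=
  p.vertices.tail.filterMap DVertex.block?

lemma laterBlocks_nil (u : DVertex a b) :
    laterBlocks (.nil u : (necklaceDigraph a b).Walk u u) = [] := rfl

lemma vertices_eq_cons {u t : DVertex a b} (p : (necklaceDigraph a b).Walk u t) :
    p.vertices = u :: p.vertices.tail := by
  cases p <;> rfl

lemma laterBlocks_cons_pair {u t : DVertex a b} {B : TwoColumn b} {L : Set (Sym2 (Fin b))}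
    {h : (B.IsStart a ∧ L = B.pathEnds) ∨ B.IsMid a} (e : (necklaceDigraph a b).Adj u (.pair B L h))
    (p : (necklaceDigraph a b).Walk (.pair B L h) t) :
    laterBlocks (.cons e p) = B :: laterBlocks p := by
  rw [laterBlocks, WeightedDigraph.Walk.vertices, List.tail_cons, vertices_eq_cons p]
  rfl

lemma laterBlocks_cons_fin {u t : DVertex a b} {B : TwoColumn b} {h : B.IsEnd a}
    (e : (necklaceDigraph a b).Adj u (.fin B h))
    (p : (necklaceDigraph a b).Walk (.fin B h) t) :
    laterBlocks (.cons e p) = B :: laterBlocks p := by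
  rw [laterBlocks, WeightedDigraph.Walk.vertices, List.tail_cons, vertices_eq_cons p]
  rfl

lemma EndWalk.blocks_eq {n : ℕ} (W : EndWalk a b n) : W.blocks = laterBlocks W.walk := by
  rw [EndWalk.blocks, vertices_eq_cons]
  rfl

/-- No edge leaves an end vertex. The sigma type lets the target and the walk be substituted
together. -/
lemma eq_nil_of_fin {t : DVertex a b} {B : TwoColumn b} {h : B.IsEnd a}
    (p : (necklaceDigraph a b).Walk (.fin B h) t) :
    (⟨t, p⟩ : Σ t, (necklaceDigraph a b).Walk (.fin B h) t) = ⟨_, .nil _⟩ := by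
  cases p with
  | nil => rfl
  | cons e _ => exact e.elim

theorem TwoColumn.IsState.isHamGraph {c : ℕ} {H : SimpleGraph ℕ} {B B' : TwoColumn b}
    {L : Set (Sym2 (Fin b))} (h : IsState a c H B L) (hB' : B'.IsEnd a) (hc : B.Compatible B')
    (hs : IsSingleCycle (H ⊔ placed c B')) :
    IsHamGraph a b (c + b + B'.rightLen) (H ⊔ placed c B') := by
  have h2 : ∀ x < c + b + B'.rightLen, deg (H ⊔ placed c B') x = 2 := by
    intro x hx
    by_cases hxc : x < c + b
    · exact h.deg_sup_lt hB'.2.2.2.2 hc hxc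
    · have := h.deg_sup_right hB'.2.2.2.2 hc ⟨x - (c + b), by omega⟩
      rw [hB'.2.2.2.1] at this
      rwa [show c + b + (x - (c + b)) = x by omega] at this
  exact ⟨fun _ _ hxy => h.sup_adj_lt hxy, fun _ _ hxy => h.sup_adj_abs hB'.1 hxy, h2,
    fun x hx y hy => hs.reachable x y (by rw [h2 x hx]; decide) (by rw [h2 y hy]; decide)⟩

/-- `H` is glued from the blocks already passed, up to and including `B`, and `c + b` is the weight
spent so far. -/
theorem isHamGraph_of_walk {u t : DVertex a b} (p : (necklaceDigraph a b).Walk u t)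
    (ht : t.IsEndVertex) (c : ℕ) (H : SimpleGraph ℕ) (B : TwoColumn b) (L : Set (Sym2 (Fin b)))
    (hBL : (B.IsStart a ∧ L = B.pathEnds) ∨ B.IsMid a) (hu : u = .pair B L hBL)
    (hst : IsState a c H B L) :
    IsHamGraph a b (c + b + p.weightSum) (H ⊔ glueFrom c (laterBlocks p)) := by
  induction p generalizing c H B L with
  | nil u =>
    subst hu
    exact ht.elim
  | @cons u v w e p ih =>
    subst hu
    cases v with
    | S => exact e.elim
    | pair B' L' h' =>
      obtain ⟨hmid, hc, rfl, hac⟩ := id e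
      have hac' := (hst.isAcyclic_augment_iff hmid.1 hmid.2.2.2 hc).1 hac
      have := ih ht _ _ _ _ h' rfl (hst.step hmid.1 hmid.2.1 hmid.2.2.2 hc hac')
      rw [laterBlocks_cons_pair, glueFrom_cons, ← sup_assoc]
      rwa [add_assoc (c + b)] at this
    | fin B' h' =>
      obtain ⟨hc, hcyc⟩ := id e
      have hs := (hst.isCycleGraph_augment_iff h' hc).1 hcyc
      obtain ⟨rfl, hp⟩ := Sigma.mk.inj_iff.1 (eq_nil_of_fin p)
      obtain rfl := eq_of_heq hp
      rw [laterBlocks_cons_fin, laterBlocks_nil, glueFrom_cons, glueFrom_nil, sup_bot_eq]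
      exact hst.isHamGraph h' hc hs

theorem EndWalk.isHamGraph {n : ℕ} (W : EndWalk a b n) : IsHamGraph a b n (glue W.blocks) := by
  rw [W.blocks_eq, ← glueFrom_zero]
  obtain ⟨t, p, ht, rfl⟩ := W
  cases p with
  | nil => exact ht.elim
  | @cons _ v _ e p =>
    cases v with
    | S => exact e.elim
    | pair B L h =>
      have := isHamGraph_of_walk p ht b _ B L h rfl (e.2.1 ▸ isState_start e.1 e.2.2)
      simp only [laterBlocks_cons_pair, glueFrom_cons, zero_add]
      rwa [← two_mul] at this
    | fin B h => exact e.elim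

/-! ### The blocks of a Hamiltonian cycle -/

/-- The subgraph of `K` induced on the numbers below `m`. -/
def below (K : SimpleGraph ℕ) (m : ℕ) : SimpleGraph ℕ where
  Adj x y := K.Adj x y ∧ x < m ∧ y < m
  symm := ⟨fun _ _ h => ⟨h.1.symm, h.2.2, h.2.1⟩⟩
  loopless := ⟨fun _ h => h.1.ne rfl⟩

lemma below_le (K : SimpleGraph ℕ) (m : ℕ) : below K m ≤ K := fun _ _ h => h.1

/-- The first block of `K`. -/
def firstBlock (b : ℕ) (K : SimpleGraph ℕ) : TwoColumn b where
  rightLen := b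
  graph := K.comap Fin.val

/-- The block of `K` whose left column starts at `c` and whose right column has length `s`. -/
def window (b : ℕ) (K : SimpleGraph ℕ) (c s : ℕ) : TwoColumn b where
  rightLen := s
  graph :=
    -- Edges inside the left column belong to the preceding block, so they are left out here.
    { Adj := fun u v => K.Adj (c + u) (c + v) ∧ (b ≤ u.val ∨ b ≤ v.val)
      symm := ⟨fun _ _ h => ⟨h.1.symm, h.2.symm⟩⟩
      loopless := ⟨fun _ h => h.1.ne rfl⟩ }

lemma placed_firstBlock (K : SimpleGraph ℕ) : placed 0 (firstBlock b K) = below K (b + b) := by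
  ext x y
  rw [placed_adj]
  constructor
  · rintro ⟨u, v, h, rfl, rfl⟩
    rw [zero_add, zero_add]
    exact ⟨h, u.2, v.2⟩
  · rintro ⟨h, hx, hy⟩
    exact ⟨⟨x, hx⟩, ⟨y, hy⟩, h, (zero_add x).symm, (zero_add y).symm⟩

lemma noLeftEdge_window (K : SimpleGraph ℕ) (c s : ℕ) : (window b K c s).NoLeftEdge := by
  rintro i j ⟨-, h | h⟩
  · exact absurd i.2 (not_lt.2 h)
  · exact absurd j.2 (not_lt.2 h)

lemma deg_below_of_le {K : SimpleGraph ℕ} {m x : ℕ} (hx : m ≤ x) : deg (below K m) x = 0 :=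
  deg_eq_zero_of_not_adj fun _ h => absurd h.2.1 (not_lt.2 hx)

/-! ### Cutting a Hamiltonian cycle into windows -/

namespace IsHamGraph

variable {n : ℕ} {K : SimpleGraph ℕ}

lemma finite_neighborSet (hK : IsHamGraph a b n K) (x : ℕ) : (K.neighborSet x).Finite :=
  finite_neighborSet_of_support (finite_support_of_lt n hK.adj_lt) x

lemma le_add (hK : IsHamGraph a b n K) (hab : a < b) {x y : ℕ} (h : K.Adj x y) : y ≤ x + b := by
  rcases hK.adj_abs x y h with h | h <;> rw [abs_eq (by positivity)] at h <;> omega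

lemma deg_le_two (hK : IsHamGraph a b n K) (x : ℕ) : deg K x ≤ 2 := by
  by_cases hx : x < n
  · rw [hK.deg_eq_two x hx]
  · rw [deg_eq_zero_of_not_adj fun y h => hx (hK.adj_lt x y h)]
    omega

lemma below_eq (hK : IsHamGraph a b n K) : below K n = K := by
  ext x y
  exact ⟨fun h => h.1, fun h => ⟨h, hK.adj_lt _ _ h, hK.adj_lt _ _ h.symm⟩⟩

lemma deg_below_le_two (hK : IsHamGraph a b n K) (m x : ℕ) : deg (below K m) x ≤ 2 :=
  (deg_mono (below_le K m) (hK.finite_neighborSet x)).trans (hK.deg_le_two x)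

lemma deg_below (hK : IsHamGraph a b n K) (hab : a < b) {m x : ℕ} (hxm : x < m) (hxn : x < n)
    (hm : x + b < m ∨ n ≤ m) : deg (below K m) x = 2 := by
  rw [← hK.deg_eq_two x hxn, deg, deg]
  congr 1
  ext y
  refine ⟨fun h => h.1, fun h => ⟨h, hxm, ?_⟩⟩
  have h1 := hK.le_add hab h
  have h2 := hK.adj_lt _ _ h.symm
  omega

/-- An edge with an end at or beyond `c + b` has its other end at least `c`, as no edge is longer
than `b`; hence it lies in the window. -/
lemma below_sup_placed_window (hK : IsHamGraph a b n K) (hab : a < b) (c s : ℕ) :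
    below K (c + b) ⊔ placed c (window b K c s) = below K (c + b + s) := by
  ext x y
  rw [sup_adj, placed_adj]
  constructor
  · rintro (⟨h, hx, hy⟩ | ⟨u, v, h, rfl, rfl⟩)
    · exact ⟨h, by omega, by omega⟩
    · have hu : u.val < b + s := u.2
      have hv : v.val < b + s := v.2
      exact ⟨h.1, by omega, by omega⟩
  · rintro ⟨h, hx, hy⟩
    by_cases hlt : x < c + b ∧ y < c + b
    · exact Or.inl ⟨h, hlt⟩
    · right
      have h1 := hK.le_add hab h
      have h2 := hK.le_add hab h.symm
      obtain ⟨u, rfl⟩ := Nat.exists_eq_add_of_le (show c ≤ x by omega)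
      obtain ⟨v, rfl⟩ := Nat.exists_eq_add_of_le (show c ≤ y by omega)
      exact ⟨⟨u, show u < b + s by omega⟩, ⟨v, show v < b + s by omega⟩,
        ⟨h, by simp only; omega⟩, rfl, rfl⟩

lemma deg_below_add_deg_window (hK : IsHamGraph a b n K) (hab : a < b) (c s x : ℕ) :
    deg (below K (c + b)) x + deg (placed c (window b K c s)) x = deg (below K (c + b + s)) x := by
  have hfin : ((below K (c + b)).neighborSet x).Finite :=
    (hK.finite_neighborSet x).subset fun _ h => h.1
  rw [← hK.below_sup_placed_window hab, deg_sup_of_disjoint hfin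
    (finite_neighborSet_of_support (finite_support_placed _ _) _)]
  intro w hw hw'
  have h1 := hw.2
  rcases (noLeftEdge_window K c s).le_of_placed_adj hw' with h | h <;> omega

lemma isPreBlock_window (hK : IsHamGraph a b n K) (hab : a < b) (c s : ℕ) :
    (window b K c s).IsPreBlock a := by
  refine ⟨fun u v h => ⟨h.ne, ?_⟩, fun v => ?_⟩
  · have := hK.adj_abs _ _ h.1
    push_cast at this
    rwa [add_sub_add_left_eq_sub] at this
  · have h1 := hK.deg_below_add_deg_window hab c s (c + v)
    have h2 := hK.deg_below_le_two (c + b + s) (c + v)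
    rw [← deg_placed c]
    omega

lemma deg_window_right (hK : IsHamGraph a b n K) (hab : a < b) (c s : ℕ) (i : Fin s) :
    deg (window b K c s).graph ((window b K c s).right i) =
      deg (below K (c + b + s)) (c + b + i) := by
  rw [← hK.deg_below_add_deg_window hab, deg_below_of_le (by omega), zero_add]
  exact (deg_placed_right c (window b K c s) i).symm

lemma compatible_window (hK : IsHamGraph a b n K) (hab : a < b) {c s : ℕ} {B : TwoColumn b}
    {L : Set (Sym2 (Fin b))} (hst : IsState a c (below K (c + b)) B L)
    (hs : s = b ∨ n = c + b + s) (hn : c + b < n) : B.Compatible (window b K c s) := by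
  rw [compatible_iff hst.rightLen (noLeftEdge_window K c s)]
  intro i
  rw [← hst.deg_right, ← deg_placed_left c, hK.deg_below_add_deg_window hab]
  exact hK.deg_below hab (by omega) (by omega) (by omega)

/-- If a component of the initial segment had only degrees two, it would already contain all its
edges of `K` and be closed in `K`. Connectedness would put `n - 1` in it, yet that vertex is
isolated below `m`. -/
lemma reachesEnds_below (hK : IsHamGraph a b n K) {m : ℕ} (hm : m < n) :
    ReachesEnds (below K m) := by
  intro v
  by_cases hv : m ≤ v
  · exact ⟨v, Reachable.refl v, by rw [deg_below_of_le hv]; omega⟩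
  by_contra! hcon
  have hmem : n - 1 ∈ {x | (below K m).Reachable v x} := by
    refine mem_of_reachable ?_ (hK.reachable v (by omega) (n - 1) (by omega)) (Reachable.refl v)
    intro x hx y hxy
    have heq : (below K m).neighborSet x = K.neighborSet x :=
      Set.eq_of_subset_of_ncard_le (fun _ h => h.1)
        ((hK.deg_le_two x).trans (hcon x hx)) (hK.finite_neighborSet x)
    have hy : y ∈ (below K m).neighborSet x := heq ▸ hxy
    exact hx.trans (Adj.reachable hy)
  have := hcon _ hmem
  rw [deg_below_of_le (by omega)] at this
  omega

lemma isSingleCycle (hK : IsHamGraph a b n K) (hn : 0 < n) : IsSingleCycle K := by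
  have key : ∀ x, deg K x ≠ 0 → x < n := fun x hx => by
    obtain ⟨y, hy⟩ := (deg_ne_zero_iff (hK.finite_neighborSet x)).1 hx
    exact hK.adj_lt x y hy
  refine ⟨⟨0, by rw [hK.deg_eq_two 0 hn]; decide⟩, fun x => ?_,
    fun x y hx hy => hK.reachable x (key x hx) y (key y hy)⟩
  by_cases hx : deg K x = 0
  · exact Or.inl hx
  · exact Or.inr (hK.deg_eq_two x (key x hx))

lemma isEnd_window (hK : IsHamGraph a b n K) (hab : a < b) {c s : ℕ} (hn : n = c + b + s)
    (h1 : 1 ≤ s) (hs : s ≤ b) : (window b K c s).IsEnd a := by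
  refine ⟨hK.isPreBlock_window hab c s, h1, hs, fun i => ?_, noLeftEdge_window K c s⟩
  have hi : i.val < s := i.2
  exact (hK.deg_window_right hab c s i).trans
    (hK.deg_below hab (by omega) (by omega) (by omega))

/-- If the right column had all degrees two, so would every vertex below `c + b + b`, and the
component of `0` in this proper initial segment could not reach an end. -/
lemma isMid_window (hK : IsHamGraph a b n K) (hab : a < b) {c : ℕ} (hn : c + b + b < n) :
    (window b K c b).IsMid a := by
  refine ⟨hK.isPreBlock_window hab c b, rfl, ?_, noLeftEdge_window K c b⟩
  by_contra! hcon
  have h2 : ∀ x < c + b + b, 2 ≤ deg (below K (c + b + b)) x := by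
    intro x hx
    by_cases hxc : x < c + b
    · exact (hK.deg_below hab hx (by omega) (by omega)).ge
    · have h1 := hcon (⟨x - (c + b), by omega⟩ : Fin b)
      have h3 := hK.deg_window_right hab c b ⟨x - (c + b), by omega⟩
      rw [show c + b + (x - (c + b)) = x by omega] at h3
      rw [← h3]
      exact h1
  obtain ⟨w, hw, hd⟩ := hK.reachesEnds_below hn 0
  have hlt : w < c + b + b := by
    by_cases hne : w = 0
    · omega
    · obtain ⟨y, hy⟩ := exists_adj_of_reachable_ne hw.symm hne
      exact hy.2.1
  have := h2 w hlt
  omega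

theorem exists_walk (hK : IsHamGraph a b n K) (hab : a < b) (m : ℕ) :
    ∀ (c : ℕ) (B : TwoColumn b) (L : Set (Sym2 (Fin b)))
      (h : (B.IsStart a ∧ L = B.pathEnds) ∨ B.IsMid a),
      n = c + b + m → 0 < m → IsState a c (below K (c + b)) B L →
      ∃ (t : DVertex a b) (p : (necklaceDigraph a b).Walk (.pair B L h) t),
        t.IsEndVertex ∧ p.weightSum = m ∧
          below K (c + b) ⊔ glueFrom c (laterBlocks p) = K := by
  induction m using Nat.strong_induction_on with
  | _ m ih =>
  intro c B L h hn hm hst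
  -- Here `m` counts the vertices still uncovered. At `m = b` the last column is full and the block
  -- must be an end block: all its right degrees are two.
  by_cases hmb : m ≤ b
  · have hend := hK.isEnd_window hab hn hm hmb
    have hc := hK.compatible_window hab hst (Or.inr hn) (by omega)
    have hsup : below K (c + b) ⊔ placed c (window b K c m) = K := by
      rw [hK.below_sup_placed_window hab, ← hn, hK.below_eq]
    have hcyc := (hst.isCycleGraph_augment_iff hend hc).2
      (by rw [hsup]; exact hK.isSingleCycle (by omega))
    have e : (necklaceDigraph a b).Adj (.pair B L h) (.fin _ hend) := ⟨hc, hcyc⟩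
    refine ⟨_, .cons e (.nil _), trivial, rfl, ?_⟩
    rw [laterBlocks_cons_fin, laterBlocks_nil, glueFrom_cons, glueFrom_nil, sup_bot_eq, hsup]
  · have hmid := hK.isMid_window hab (c := c) (by omega)
    have hc := hK.compatible_window hab (s := b) hst (Or.inl rfl) (by omega)
    have hsup := hK.below_sup_placed_window hab c b
    have hr : ReachesEnds (below K (c + b) ⊔ placed c (window b K c b)) := by
      rw [hsup]
      exact hK.reachesEnds_below (by omega)
    have hac := (hst.isAcyclic_augment_iff hmid.1 hmid.2.2.2 hc).2 hr
    have hst' := hst.step hmid.1 hmid.2.1 hmid.2.2.2 hc hr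
    rw [hsup] at hst'
    obtain ⟨t, p, ht, hw, hg⟩ := ih (m - b) (by omega) (c + b) _ _ (Or.inr hmid) (by omega)
      (by omega) hst'
    have e : (necklaceDigraph a b).Adj (.pair B L h)
        (.pair _ ((window b K c b).augment L).pathEnds (Or.inr hmid)) := ⟨hmid, hc, rfl, hac⟩
    refine ⟨t, .cons e p, ht, ?_, ?_⟩
    · change b + p.weightSum = m
      omega
    · rw [laterBlocks_cons_pair, glueFrom_cons, ← sup_assoc, hsup, hg]

theorem exists_endWalk (hK : IsHamGraph a b n K) (hab : a < b) (hn : 2 * b < n) :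
    ∃ W : EndWalk a b n, glue W.blocks = K := by
  have hpl := placed_firstBlock (b := b) K
  have hdeg : ∀ v, deg (firstBlock b K).graph v ≤ 2 := fun v => by
    rw [← deg_placed 0, hpl]
    exact hK.deg_below_le_two _ _
  have hstart : (firstBlock b K).IsStart a := by
    refine ⟨⟨fun u v h => ⟨h.ne, hK.adj_abs _ _ h⟩, hdeg⟩, rfl, fun i => ?_⟩
    rw [← deg_placed_left 0, hpl]
    exact hK.deg_below hab (by omega) (by omega) (by omega)
  have hac : (firstBlock b K).graph.IsAcyclic := by
    rw [isAcyclic_iff_reachesEnds hdeg, ← reachesEnds_map_iff (shiftEmb 0 _)]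
    change ReachesEnds (placed 0 (firstBlock b K))
    rw [hpl]
    exact hK.reachesEnds_below (by omega)
  have hst := isState_start hstart hac
  rw [hpl] at hst
  obtain ⟨t, p, ht, hw, hg⟩ := hK.exists_walk hab (n - 2 * b) b _ _ (Or.inl ⟨hstart, rfl⟩)
    (by omega) (by omega) hst
  have e : (necklaceDigraph a b).Adj .S (.pair (firstBlock b K) _ (Or.inl ⟨hstart, rfl⟩)) :=
    ⟨hstart, rfl, hac⟩
  refine ⟨⟨t, .cons e p, ht, ?_⟩, ?_⟩
  · change 2 * b + p.weightSum = n
    omega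
  · rw [EndWalk.blocks_eq, ← glueFrom_zero]
    change glueFrom 0 (laterBlocks (.cons e p)) = K
    rw [laterBlocks_cons_pair, glueFrom_cons, zero_add, hpl, hg]

end IsHamGraph

end Necklace

namespace Necklace

open SimpleGraph TwoColumn

variable {a b : ℕ}

/-! ### A walk is determined by the graph glued from its blocks -/

lemma TwoColumn.eq_of_placed_eq {c : ℕ} {B B' : TwoColumn b} (hlen : B.rightLen = B'.rightLen)
    (h : placed c B = placed c B') : B = B' := by
  obtain ⟨s, G⟩ := B
  obtain ⟨s', G'⟩ := B'
  obtain rfl : s = s' := hlen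
  obtain rfl : G = G' := SimpleGraph.map_injective _ h
  rfl

lemma glueFrom_laterBlocks_adj {u t : DVertex a b} (p : (necklaceDigraph a b).Walk u t) (c : ℕ)
    (hu : u ≠ .S) {x y : ℕ} (h : (glueFrom c (laterBlocks p)).Adj x y) :
    c + b ≤ x ∨ c + b ≤ y := by
  induction p generalizing c with
  | nil u =>
    rw [laterBlocks_nil, glueFrom_nil] at h
    exact h.elim
  | @cons u v w e p ih =>
    cases v with
    | S => cases u <;> exact e.elim
    | pair B' L' h' =>
      rw [laterBlocks_cons_pair, glueFrom_cons] at h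
      have hB' : B'.NoLeftEdge := by
        cases u with
        | S => exact absurd rfl hu
        | pair => exact e.1.2.2.2
        | fin => exact e.elim
      rcases h with h | h
      · exact hB'.le_of_placed_adj h
      · have := ih (c + b) (by simp) h
        omega
    | fin B' h' =>
      rw [laterBlocks_cons_fin, glueFrom_cons] at h
      rcases h with h | h
      · exact h'.2.2.2.2.le_of_placed_adj h
      · have := ih (c + b) (by simp) h
        omega

/-- The edges of the first block are those with both ends below `c + b + b`, and the remaining
blocks own all others, so the glued graph splits in only one way. -/
lemma eq_and_glueFrom_eq {c : ℕ} {B B' : TwoColumn b} {Bs Bs' : List (TwoColumn b)}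
    (hB : B.rightLen = b) (hB' : B'.rightLen = b)
    (hBs : ∀ x y, (glueFrom (c + b) Bs).Adj x y → c + b + b ≤ x ∨ c + b + b ≤ y)
    (hBs' : ∀ x y, (glueFrom (c + b) Bs').Adj x y → c + b + b ≤ x ∨ c + b + b ≤ y)
    (h : glueFrom c (B :: Bs) = glueFrom c (B' :: Bs')) :
    B = B' ∧ glueFrom (c + b) Bs = glueFrom (c + b) Bs' := by
  have key : ∀ {D : TwoColumn b} {Ds : List (TwoColumn b)}, D.rightLen = b →
      (∀ x y, (glueFrom (c + b) Ds).Adj x y → c + b + b ≤ x ∨ c + b + b ≤ y) → ∀ x y,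
      ((placed c D).Adj x y ↔
        (glueFrom c (D :: Ds)).Adj x y ∧ x < c + b + b ∧ y < c + b + b) ∧
      ((glueFrom (c + b) Ds).Adj x y ↔
        (glueFrom c (D :: Ds)).Adj x y ∧ (c + b + b ≤ x ∨ c + b + b ≤ y)) := by
    intro D Ds hD hDs x y
    rw [glueFrom_cons, sup_adj]
    have h1 : (placed c D).Adj x y → x < c + b + b ∧ y < c + b + b := fun h => by
      have hx := (placed_adj_lt h).2
      have hy := (placed_adj_lt h.symm).2
      omega
    have h2 := hDs x y
    constructor
    · refine ⟨fun h => ⟨Or.inl h, h1 h⟩, ?_⟩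
      rintro ⟨h | h, hlt⟩
      · exact h
      · have := h2 h
        omega
    · refine ⟨fun h => ⟨Or.inr h, h2 h⟩, ?_⟩
      rintro ⟨h | h, hle⟩
      · have := h1 h
        omega
      · exact h
  constructor
  · refine TwoColumn.eq_of_placed_eq (c := c) (hB.trans hB'.symm) ?_
    ext x y
    rw [(key hB hBs x y).1, (key hB' hBs' x y).1, h]
  · ext x y
    rw [(key hB hBs x y).2, (key hB' hBs' x y).2, h]

lemma weightSum_pos {t : DVertex a b} (hb : 0 < b) {B : TwoColumn b} {L : Set (Sym2 (Fin b))}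
    {h : (B.IsStart a ∧ L = B.pathEnds) ∨ B.IsMid a}
    (p : (necklaceDigraph a b).Walk (.pair B L h) t) (ht : t.IsEndVertex) : 0 < p.weightSum := by
  cases p with
  | nil => exact ht.elim
  | @cons _ v _ e p =>
    cases v with
    | S => exact e.elim
    | pair B' L' h' => exact Nat.add_pos_left hb _
    | fin B' h' => exact Nat.add_pos_left h'.2.1 _

/-- A glued graph lives on all naturals and does not record the length of the last column; the
equality of weights supplies it. -/
theorem walk_eq_of_glueFrom_eq (hb : 0 < b) {u t t' : DVertex a b}
    (p : (necklaceDigraph a b).Walk u t) (p' : (necklaceDigraph a b).Walk u t')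
    (ht : t.IsEndVertex) (ht' : t'.IsEndVertex) (c : ℕ) (hw : p.weightSum = p'.weightSum)
    (hg : glueFrom c (laterBlocks p) = glueFrom c (laterBlocks p')) :
    (⟨t, p⟩ : Σ t, (necklaceDigraph a b).Walk u t) = ⟨t', p'⟩ := by
  induction p generalizing t' c with
  | nil u =>
    cases u with
    | S => exact ht.elim
    | pair => exact ht.elim
    | fin => exact (eq_nil_of_fin p').symm
  | @cons u v w e p ih =>
    cases p' with
    | nil => cases u with
      | S => exact ht'.elim
      | pair => exact ht'.elim
      | fin => exact e.elim
    | @cons _ v' _ e' p' =>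
    suffices hv : v = v' ∧ p.weightSum = p'.weightSum ∧
        glueFrom (c + b) (laterBlocks p) = glueFrom (c + b) (laterBlocks p') by
      obtain ⟨rfl, hw', hg'⟩ := hv
      obtain ⟨rfl, hp⟩ := Sigma.mk.inj_iff.1 (ih p' ht ht' (c + b) hw' hg')
      rw [eq_of_heq hp]
    cases v with
    | S => cases u <;> exact e.elim
    | pair B L h =>
      cases v' with
      | S => cases u <;> exact e'.elim
      | pair B' L' h' =>
        rw [laterBlocks_cons_pair, laterBlocks_cons_pair] at hg
        have hlen : ∀ {D : TwoColumn b} {M : Set (Sym2 (Fin b))},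
            (D.IsStart a ∧ M = D.pathEnds) ∨ D.IsMid a → D.rightLen = b := by
          rintro D M (hD | hD)
          · exact hD.1.2.1
          · exact hD.2.1
        obtain ⟨rfl, hg'⟩ := eq_and_glueFrom_eq (hlen h) (hlen h')
          (fun x y hxy => glueFrom_laterBlocks_adj p (c + b) (by simp) hxy)
          (fun x y hxy => glueFrom_laterBlocks_adj p' (c + b) (by simp) hxy) hg
        cases u with
        | S =>
          -- Labels are no additional choice: the edge from `S`, or from the preceding pair,
          -- prescribes them.
          obtain rfl : L = L' := e.2.1.trans e'.2.1.symm
          exact ⟨rfl, Nat.add_left_cancel hw, hg'⟩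
        | pair =>
          obtain rfl : L = L' := e.2.2.1.symm.trans e'.2.2.1
          exact ⟨rfl, Nat.add_left_cancel hw, hg'⟩
        | fin => exact e.elim
      | fin B' h' =>
        cases u with
        | S => exact e'.elim
        | fin => exact e.elim
        | pair =>
          have h1 := weightSum_pos hb p ht
          obtain ⟨rfl, hp⟩ := Sigma.mk.inj_iff.1 (eq_nil_of_fin p')
          obtain rfl := eq_of_heq hp
          -- One walk ends here with weight at most `b`, while the other spends `b` and must still
          -- pay a positive amount to reach an end vertex.
          have h2 : b + p.weightSum = B'.rightLen + 0 := hw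
          have := h'.2.2.1
          omega
    | fin B h =>
      obtain ⟨rfl, hp⟩ := Sigma.mk.inj_iff.1 (eq_nil_of_fin p)
      obtain rfl := eq_of_heq hp
      cases u with
      | S => exact e.elim
      | fin => exact e.elim
      | pair =>
      cases v' with
      | S => exact e'.elim
      | pair B' L' h' =>
        have h1 := weightSum_pos hb p' ht'
        have h2 : B.rightLen + 0 = b + p'.weightSum := hw
        have := h.2.2.1
        omega
      | fin B' h' =>
        obtain ⟨rfl, hp'⟩ := Sigma.mk.inj_iff.1 (eq_nil_of_fin p')
        obtain rfl := eq_of_heq hp'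
        rw [laterBlocks_cons_fin, laterBlocks_cons_fin, laterBlocks_nil, laterBlocks_nil,
          glueFrom_cons, glueFrom_cons, glueFrom_nil, sup_bot_eq, sup_bot_eq] at hg
        obtain rfl := TwoColumn.eq_of_placed_eq hw hg
        exact ⟨rfl, rfl, rfl⟩

theorem EndWalk.eq_of_glue_eq (hb : 0 < b) {n : ℕ} {W W' : EndWalk a b n}
    (h : glue W.blocks = glue W'.blocks) : W = W' := by
  rw [W.blocks_eq, W'.blocks_eq, ← glueFrom_zero, ← glueFrom_zero] at h
  have := walk_eq_of_glueFrom_eq hb W.walk W'.walk W.isEnd W'.isEnd 0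
    (W.weightSum_eq.trans W'.weightSum_eq.symm) h
  obtain ⟨t, p, ht, hp⟩ := W
  obtain ⟨t', p', ht', hp'⟩ := W'
  obtain ⟨rfl, hpp⟩ := Sigma.mk.inj_iff.1 this
  obtain rfl := eq_of_heq hpp
  rfl

/-! ### Hamiltonian cycles as graphs on the naturals -/

theorem isHamGraph_map {n : ℕ} (hn : 0 < n) {C : (necklaceGraph a b n).Subgraph}
    (hC : C ∈ hamiltonianCycles (necklaceGraph a b n)) :
    IsHamGraph a b n (C.spanningCoe.map Fin.valEmbedding) := by
  have : Nonempty (Fin n) := ⟨⟨0, hn⟩⟩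
  rw [mem_hamiltonianCycles_iff] at hC
  refine ⟨?_, ?_, fun x hx => ?_, fun x hx y hy => ?_⟩
  · intro x y h
    obtain ⟨u, v, -, rfl, -⟩ := (map_adj _ _ _ _).1 h
    exact u.2
  · intro x y h
    obtain ⟨u, v, huv, rfl, rfl⟩ := (map_adj _ _ _ _).1 h
    exact (C.adj_sub huv).2
  · exact (deg_map Fin.valEmbedding (⟨x, hx⟩ : Fin n)).trans (hC.1 _)
  · exact (reachable_map_iff Fin.valEmbedding (u := ⟨x, hx⟩) (v := ⟨y, hy⟩)).2 (hC.2 _ _)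

namespace IsHamGraph

variable {n : ℕ} {K : SimpleGraph ℕ}

/-- The subgraph of `G_{a,b}(n)` given by a Hamiltonian cycle on the naturals. -/
def toSubgraph (hK : IsHamGraph a b n K) : (necklaceGraph a b n).Subgraph where
  verts := Set.univ
  Adj x y := K.Adj x y
  adj_sub h := ⟨fun hxy => h.ne (congrArg Fin.val hxy), hK.adj_abs _ _ h⟩
  edge_vert _ := trivial
  symm := ⟨fun _ _ h => h.symm⟩

lemma map_toSubgraph (hK : IsHamGraph a b n K) :
    hK.toSubgraph.spanningCoe.map Fin.valEmbedding = K := by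
  ext x y
  rw [map_adj]
  constructor
  · rintro ⟨u, v, h, rfl, rfl⟩
    exact h
  · intro h
    exact ⟨⟨x, hK.adj_lt _ _ h⟩, ⟨y, hK.adj_lt _ _ h.symm⟩, h, rfl, rfl⟩

lemma toSubgraph_mem (hK : IsHamGraph a b n K) (hn : 0 < n) :
    hK.toSubgraph ∈ hamiltonianCycles (necklaceGraph a b n) := by
  have : Nonempty (Fin n) := ⟨⟨0, hn⟩⟩
  rw [mem_hamiltonianCycles_iff]
  refine ⟨fun v => ?_, fun v w => ?_⟩
  · rw [← deg_map Fin.valEmbedding, hK.map_toSubgraph]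
    exact hK.deg_eq_two _ v.2
  · rw [← reachable_map_iff Fin.valEmbedding, hK.map_toSubgraph]
    exact hK.reachable _ v.2 _ w.2

end IsHamGraph

/-- A `Subgraph` also carries a vertex set, which for a Hamiltonian cycle is everything, so its
edges determine it. -/
lemma hamiltonianCycles_ext {V : Type*} [Finite V] [Nonempty V] [DecidableEq V]
    {G : SimpleGraph V} {C C' : G.Subgraph} (hC : C ∈ hamiltonianCycles G)
    (hC' : C' ∈ hamiltonianCycles G) (h : C.spanningCoe = C'.spanningCoe) : C = C' := by
  have key : ∀ {D : G.Subgraph}, D ∈ hamiltonianCycles G → D.verts = Set.univ := by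
    intro D hD
    refine Set.eq_univ_of_forall fun x => ?_
    have h2 := (mem_hamiltonianCycles_iff.1 hD).1 x
    obtain ⟨y, hy⟩ := (deg_ne_zero_iff (Set.toFinite _)).1 (by rw [h2]; decide)
    exact D.edge_vert hy
  refine Subgraph.ext ((key hC).trans (key hC').symm) ?_
  exact congrArg SimpleGraph.Adj h

/-! ### Finiteness of the digraph -/

instance finite_rightLen_le (b : ℕ) : Finite {B : TwoColumn b // B.rightLen ≤ b} := by
  let f : (Σ s : Fin (b + 1), SimpleGraph (Fin (b + s))) → {B : TwoColumn b // B.rightLen ≤ b} :=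
    fun x => ⟨⟨x.1, x.2⟩, Nat.lt_succ_iff.1 x.1.2⟩
  refine Finite.of_surjective f ?_
  rintro ⟨⟨s, G⟩, hs⟩
  exact ⟨⟨⟨s, Nat.lt_succ_iff.2 hs⟩, G⟩, rfl⟩

theorem finite_dVertex (a b : ℕ) : Finite (DVertex a b) := by
  let T := {B : TwoColumn b // B.rightLen ≤ b}
  have hlen : ∀ {B : TwoColumn b} {L : Set (Sym2 (Fin b))},
      (B.IsStart a ∧ L = B.pathEnds) ∨ B.IsMid a → B.rightLen ≤ b := by
    rintro B L (h | h)
    · exact h.1.2.1.le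
    · exact h.2.1.le
  let f : DVertex a b → Option ((T × Set (Sym2 (Fin b))) ⊕ T)
    | .S => none
    | .pair B L h => some (.inl (⟨B, hlen h⟩, L))
    | .fin B h => some (.inr ⟨B, h.2.2.1⟩)
  refine Finite.of_injective f ?_
  rintro (_ | ⟨B, L, h⟩ | ⟨B, h⟩) (_ | ⟨B', L', h'⟩ | ⟨B', h'⟩) heq <;>
    simp only [f, reduceCtorEq, Option.some.injEq, Sum.inl.injEq, Sum.inr.injEq, Prod.mk.injEq]
      at heq
  · rfl
  · obtain ⟨hB, rfl⟩ := heq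
    obtain rfl := congrArg Subtype.val hB
    rfl
  · obtain rfl := congrArg Subtype.val heq
    rfl

end Necklace

/-- `D_{a,b}` is finite and, for `n > 2b`, the Hamiltonian cycles of `G_{a,b}(n)` are in bijection
with the walks in `D_{a,b}` from `S` to an end vertex of total weight `n`; the correspondence
glues the blocks along a walk to a Hamiltonian cycle. -/
theorem mainTheorem2 (a b : ℕ) (ha : 0 < a) (hab : a < b) (hcop : Nat.Coprime a b) :
    Finite (Necklace.DVertex a b) ∧
    ∀ n : ℕ, 2 * b < n →
      ∃ Φ : Necklace.hamiltonianCycles (Necklace.necklaceGraph a b n) ≃ Necklace.EndWalk a b n,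
        ∀ C : Necklace.hamiltonianCycles (Necklace.necklaceGraph a b n),
          Necklace.TwoColumn.glue (Φ C).blocks =
            C.1.spanningCoe.map Fin.valEmbedding := by
  refine ⟨Necklace.finite_dVertex a b, fun n hn => ?_⟩
  have hn0 : 0 < n := by omega
  have : Nonempty (Fin n) := ⟨⟨0, hn0⟩⟩
  -- Gluing is the explicit direction; the required equivalence is its inverse.
  let f : Necklace.EndWalk a b n → Necklace.hamiltonianCycles (Necklace.necklaceGraph a b n) :=
    fun W => ⟨W.isHamGraph.toSubgraph, W.isHamGraph.toSubgraph_mem hn0⟩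
  have hf : ∀ W, (f W).1.spanningCoe.map Fin.valEmbedding = Necklace.TwoColumn.glue W.blocks :=
    fun W => W.isHamGraph.map_toSubgraph
  have hbij : Function.Bijective f := by
    constructor
    · intro W W' h
      refine Necklace.EndWalk.eq_of_glue_eq (by omega) ?_
      rw [← hf, ← hf, h]
    · intro C
      obtain ⟨W, hW⟩ := (Necklace.isHamGraph_map hn0 C.2).exists_endWalk hab hn
      refine ⟨W, Subtype.ext (Necklace.hamiltonianCycles_ext (f W).2 C.2 ?_)⟩
      exact SimpleGraph.map_injective Fin.valEmbedding ((hf W).trans hW)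
  refine ⟨(Equiv.ofBijective f hbij).symm, fun C => ?_⟩
  rw [← hf]
  exact congrArg (fun D => D.1.spanningCoe.map Fin.valEmbedding)
    ((Equiv.ofBijective f hbij).apply_symm_apply C)
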